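/- Setting. A discrete memoryless state-dependent Z-interference channel has finite alphabets $\mathcal S_1,\mathcal S_2,\mathcal X_1,\mathcal X_2,\mathcal Y_1,\mathcal Y_2$, state pairs $(S_{1,i},S_{2,i})$ that are i.i.d. over the channel uses with law $P_{S_1S_2}$, and memoryless transition probability $P_{Y_1|S_1X_1X_2}P_{Y_2|S_2X_2}$ (receiver 2 sees no interference from $X_1$). A length-$n$ code with message sets $\mathcal W_1,\mathcal W_2$ consists of encoders $x_k^n=x_k^n(w_k,s_1^n,s_2^n)$, so that both transmitters know both state sequences noncausally, and decoders $\hat w_k=\hat w_k(y_k^n)$, $k=1,2$; its average error probability is $$P_e^{(n)}=\frac1{|\mathcal W_1||\mathcal W_2|}\sum_{w_1,w_2}\Pr\{(\hat w_1,\hat w_2)\ne(w_1,w_2)\}.$$ A pair $(R_1,R_2)$ of nonnegative rates is achievable if there is a sequence of codes with $|\mathcal W_k^{(n)}|=\lceil 2^{nR_k}\rceil$, $k=1,2$, and $P_e^{(n)}\to0$ as $n\to\infty$. The capacity region is the closure of the set of achievable pairs. Mutual informations are in bits. Proposition 4. Let $U_1,U_2,V$ be auxiliary random variables with finite alphabets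 and let $(S_1,S_2,V,X_2,U_1,U_2,X_1,Y_1,Y_2)$ have a joint distribution of the form $$P_{S_1S_2}P_{V|S_1}P_{X_2|VS_1}P_{U_1|S_1}P_{U_2|S_1U_1}P_{X_1|S_1U_1U_2}P_{Y_1|S_1X_1X_2}P_{Y_2|S_2X_2}$$ for which $$I(V;U_1Y_1)\le I(V;Y_2).$$ Then every pair of nonnegative rates $(R_1,R_2)$ with $$R_1\le I(U_1;Y_1)+I(U_2;VY_1|U_1)-I(S_1;U_1U_2),\qquad R_2\le I(V;U_1Y_1)-I(S_1;V)$$ lies in the capacity region, and every such pair for which both inequalities are strict is achievable. -/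

import Mathlib

namespace StateIC

/-! ### Information measures of finitely supported random variables, in bits -/

open Classical in
/-- The probability mass function of the random variable `A` when the sample space `Ω`
carries the mass function `p`. -/
noncomputable def law {Ω α : Type*} [Fintype Ω] (p : Ω → ℝ) (A : Ω → α) (a : α) : ℝ :=
  ∑ ω, if A ω = a then p ω else 0

/-- Mutual information `I(A;B)` in bits. Terms with `P(a,b) = 0` vanish; in all the others
the denominator is positive. -/
noncomputable def mutualInfo {Ω α β : Type*} [Fintype Ω] [Fintype α] [Fintype β]
    (p : Ω → ℝ) (A : Ω → α) (B : Ω → β) : ℝ :=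
  ∑ a, ∑ b, law p (fun ω => (A ω, B ω)) (a, b) *
    Real.logb 2 (law p (fun ω => (A ω, B ω)) (a, b) / (law p A a * law p B b))

/-- Conditional mutual information `I(A;B|C)` in bits. Terms with `P(a,b,c) = 0` vanish; in
all the others the denominator is positive. -/
noncomputable def condMutualInfo {Ω α β γ : Type*} [Fintype Ω] [Fintype α] [Fintype β]
    [Fintype γ] (p : Ω → ℝ) (A : Ω → α) (B : Ω → β) (C : Ω → γ) : ℝ :=
  ∑ a, ∑ b, ∑ c, law p (fun ω => (A ω, B ω, C ω)) (a, b, c) *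
    Real.logb 2 (law p (fun ω => (A ω, B ω, C ω)) (a, b, c) * law p C c /
      (law p (fun ω => (A ω, C ω)) (a, c) * law p (fun ω => (B ω, C ω)) (b, c)))

/-! ### The state-dependent interference channel -/

/-- A discrete memoryless state-dependent interference channel: the joint law `P_{S₁S₂}` of
the state pair in one channel use (the state pairs are i.i.d. over the channel uses) and the
transition probability `P_{Y₁Y₂|S₁S₂X₁X₂}`. -/
structure Channel (S₁ S₂ X₁ X₂ Y₁ Y₂ : Type*) where
  state : PMF (S₁ × S₂)
  transition : S₁ → S₂ → X₁ → X₂ → PMF (Y₁ × Y₂)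

/-- A code of length `n` with `M₁` and `M₂` messages. Both encoders know both state sequences
noncausally; the decoders see only their own output sequence. -/
structure Code (S₁ S₂ X₁ X₂ Y₁ Y₂ : Type*) (n M₁ M₂ : ℕ) where
  enc₁ : Fin M₁ → (Fin n → S₁) → (Fin n → S₂) → (Fin n → X₁)
  enc₂ : Fin M₂ → (Fin n → S₁) → (Fin n → S₂) → (Fin n → X₂)
  dec₁ : (Fin n → Y₁) → Fin M₁
  dec₂ : (Fin n → Y₂) → Fin M₂

section Coding

variable {S₁ S₂ X₁ X₂ Y₁ Y₂ : Type*} [Fintype S₁] [Fintype S₂] [Fintype Y₁] [Fintype Y₂]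

/-- The probability that `(ŵ₁, ŵ₂) ≠ (w₁, w₂)` when `(w₁, w₂)` is sent. -/
noncomputable def Code.errorProb {n M₁ M₂ : ℕ} (C : Code S₁ S₂ X₁ X₂ Y₁ Y₂ n M₁ M₂)
    (ch : Channel S₁ S₂ X₁ X₂ Y₁ Y₂) (w₁ : Fin M₁) (w₂ : Fin M₂) : ℝ :=
  ∑ s₁ : Fin n → S₁, ∑ s₂ : Fin n → S₂, ∑ y₁ : Fin n → Y₁, ∑ y₂ : Fin n → Y₂,
    if (C.dec₁ y₁, C.dec₂ y₂) ≠ (w₁, w₂) then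
      (∏ i, (ch.state (s₁ i, s₂ i)).toReal) *
        ∏ i, (ch.transition (s₁ i) (s₂ i) (C.enc₁ w₁ s₁ s₂ i) (C.enc₂ w₂ s₁ s₂ i)
          (y₁ i, y₂ i)).toReal
    else 0

/-- The average probability of error, for independent uniform messages. -/
noncomputable def Code.avgError {n M₁ M₂ : ℕ} (C : Code S₁ S₂ X₁ X₂ Y₁ Y₂ n M₁ M₂)
    (ch : Channel S₁ S₂ X₁ X₂ Y₁ Y₂) : ℝ :=
  1 / ((M₁ : ℝ) * M₂) * ∑ w₁, ∑ w₂, C.errorProb ch w₁ w₂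

/-- The pair of nonnegative rates `(R.1, R.2)` is achievable: there are codes of every length
`n` with `2 ^ (n R₁)` and `2 ^ (n R₂)` messages (rounded up to integers) whose average error
probability tends to `0`. -/
def Channel.Achievable (ch : Channel S₁ S₂ X₁ X₂ Y₁ Y₂) (R : ℝ × ℝ) : Prop :=
  0 ≤ R.1 ∧ 0 ≤ R.2 ∧
    ∃ C : ∀ n : ℕ, Code S₁ S₂ X₁ X₂ Y₁ Y₂ n
        ⌈(2 : ℝ) ^ ((n : ℝ) * R.1)⌉₊ ⌈(2 : ℝ) ^ ((n : ℝ) * R.2)⌉₊,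
      Filter.Tendsto (fun n => (C n).avgError ch) Filter.atTop (nhds 0)

/-- The capacity region: the closure of the set of achievable rate pairs. -/
def Channel.capacityRegion (ch : Channel S₁ S₂ X₁ X₂ Y₁ Y₂) : Set (ℝ × ℝ) :=
  closure {R | ch.Achievable R}

end Coding

/-! ### The Z-interference channel -/

/-- A discrete memoryless state-dependent Z-interference channel: receiver 2 is free of
interference, and the transition probability is `P_{Y₁|S₁X₁X₂} P_{Y₂|S₂X₂}`. -/
structure ZChannel (S₁ S₂ X₁ X₂ Y₁ Y₂ : Type*) where
  state : PMF (S₁ × S₂)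
  out₁ : S₁ → X₁ → X₂ → PMF Y₁
  out₂ : S₂ → X₂ → PMF Y₂

/-- The Z-interference channel as an interference channel: given the states and the inputs,
`Y₁` and `Y₂` are independent with laws `P_{Y₁|S₁X₁X₂}` and `P_{Y₂|S₂X₂}`. -/
noncomputable def ZChannel.toChannel {S₁ S₂ X₁ X₂ Y₁ Y₂ : Type*}
    (z : ZChannel S₁ S₂ X₁ X₂ Y₁ Y₂) : Channel S₁ S₂ X₁ X₂ Y₁ Y₂ where
  state := z.state
  transition s₁ s₂ x₁ x₂ :=
    (z.out₁ s₁ x₁ x₂).bind fun y₁ => (z.out₂ s₂ x₂).map fun y₂ => (y₁, y₂)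

theorem ZChannel.toChannel_transition_apply {S₁ S₂ X₁ X₂ Y₁ Y₂ : Type*}
    (z : ZChannel S₁ S₂ X₁ X₂ Y₁ Y₂) (s₁ : S₁) (s₂ : S₂) (x₁ : X₁) (x₂ : X₂)
    (y₁ : Y₁) (y₂ : Y₂) :
    z.toChannel.transition s₁ s₂ x₁ x₂ (y₁, y₂) = z.out₁ s₁ x₁ x₂ y₁ * z.out₂ s₂ x₂ y₂ := by
  classical
  simp only [ZChannel.toChannel, PMF.bind_apply, PMF.map_apply, Prod.mk.injEq]
  rw [tsum_eq_single y₁, tsum_eq_single y₂]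
  · simp
  · intro b hb; simp [hb.symm]
  · intro b hb; simp [hb.symm]

/-- The conditional laws of the auxiliary variables `U₁`, `U₂`, `V` and of the channel inputs:
`P_{V|S₁}`, `P_{X₂|VS₁}`, `P_{U₁|S₁}`, `P_{U₂|S₁U₁}` and `P_{X₁|S₁U₁U₂}`. -/
structure InputLaws (S₁ X₁ X₂ U₁ U₂ V : Type*) where
  v : S₁ → PMF V
  x₂ : V → S₁ → PMF X₂
  u₁ : S₁ → PMF U₁
  u₂ : S₁ → U₁ → PMF U₂
  x₁ : S₁ → U₁ → U₂ → PMF X₁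

/-- The values of all the random variables of one channel use:
`(s₁, s₂, v, x₂, u₁, u₂, x₁, y₁, y₂)`. -/
abbrev Outcome (S₁ S₂ X₁ X₂ Y₁ Y₂ U₁ U₂ V : Type*) :=
  S₁ × S₂ × V × X₂ × U₁ × U₂ × X₁ × Y₁ × Y₂

namespace Outcome

variable {S₁ S₂ X₁ X₂ Y₁ Y₂ U₁ U₂ V : Type*}

abbrev s₁ (ω : Outcome S₁ S₂ X₁ X₂ Y₁ Y₂ U₁ U₂ V) : S₁ := ω.1
abbrev s₂ (ω : Outcome S₁ S₂ X₁ X₂ Y₁ Y₂ U₁ U₂ V) : S₂ := ω.2.1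
abbrev v (ω : Outcome S₁ S₂ X₁ X₂ Y₁ Y₂ U₁ U₂ V) : V := ω.2.2.1
abbrev x₂ (ω : Outcome S₁ S₂ X₁ X₂ Y₁ Y₂ U₁ U₂ V) : X₂ := ω.2.2.2.1
abbrev u₁ (ω : Outcome S₁ S₂ X₁ X₂ Y₁ Y₂ U₁ U₂ V) : U₁ := ω.2.2.2.2.1
abbrev u₂ (ω : Outcome S₁ S₂ X₁ X₂ Y₁ Y₂ U₁ U₂ V) : U₂ := ω.2.2.2.2.2.1
abbrev x₁ (ω : Outcome S₁ S₂ X₁ X₂ Y₁ Y₂ U₁ U₂ V) : X₁ := ω.2.2.2.2.2.2.1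
abbrev y₁ (ω : Outcome S₁ S₂ X₁ X₂ Y₁ Y₂ U₁ U₂ V) : Y₁ := ω.2.2.2.2.2.2.2.1
abbrev y₂ (ω : Outcome S₁ S₂ X₁ X₂ Y₁ Y₂ U₁ U₂ V) : Y₂ := ω.2.2.2.2.2.2.2.2

end Outcome

/-- The joint mass function
`P_{S₁S₂} P_{V|S₁} P_{X₂|VS₁} P_{U₁|S₁} P_{U₂|S₁U₁} P_{X₁|S₁U₁U₂} P_{Y₁|S₁X₁X₂} P_{Y₂|S₂X₂}`. -/
noncomputable def jointMass {S₁ S₂ X₁ X₂ Y₁ Y₂ U₁ U₂ V : Type*}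
    (z : ZChannel S₁ S₂ X₁ X₂ Y₁ Y₂) (q : InputLaws S₁ X₁ X₂ U₁ U₂ V)
    (ω : Outcome S₁ S₂ X₁ X₂ Y₁ Y₂ U₁ U₂ V) : ℝ :=
  (z.state (ω.s₁, ω.s₂)).toReal * (q.v ω.s₁ ω.v).toReal * (q.x₂ ω.v ω.s₁ ω.x₂).toReal *
    (q.u₁ ω.s₁ ω.u₁).toReal * (q.u₂ ω.s₁ ω.u₁ ω.u₂).toReal *
    (q.x₁ ω.s₁ ω.u₁ ω.u₂ ω.x₁).toReal *
    (z.out₁ ω.s₁ ω.x₁ ω.x₂ ω.y₁).toReal * (z.out₂ ω.s₂ ω.x₂ ω.y₂).toReal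

end StateIC

/-! The scheme is Gelfand–Pinsker binning at both transmitters, using only the state S₁. Codewords
for U = (U₁, U₂) and for V are drawn i.i.d. from their marginal laws and divided into bins, one bin
per message. The bin rates r and k lie slightly above I(S₁;U₁U₂) and I(S₁;V), so that a bin contains
a codeword fitting the state sequence. Receiver 2 looks for a bin with a V-codeword that fits its
output, which succeeds if R₂ + k < I(V;Y₂). Receiver 1 looks for a bin with a U-codeword that fits
its output together with some V-codeword, no matter which. A false U beside the true V is excluded
if R₁ + r < I(U₁;Y₁) + I(U₂;VY₁|U₁). A false U beside a false V is excluded if R₁ + r + R₂ + k is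
below the same sum increased by I(V;U₁Y₁). For r and k near their lower limits, the first of these
is the bound on R₁, the second follows by adding the bound on R₂, and I(V;U₁Y₁) ≤ I(V;Y₂) gives the
condition of receiver 2.

Likelihood ratios take the place of typical sets. An encoder selects an index of the bin with
probability proportional to the density of the codeword given the state, capped by density over bin
size. Hence, on average over the codebooks, the selected codewords are dominated by the true joint
law while the others remain independent of them (`sum_weighted_le`, `iidExp_failures_le`). The mass
lost by the cap vanishes by a second moment bound (`iidExp_binSelect_deficit_le`). The decoders
compare `leftDensity`, `jointDensity` and `infoDensity` with thresholds. The logarithms of these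
densities have the required informations as means, so the weak law handles the true codewords. Their
means over false codewords are at most one, so Markov's inequality bounds false alarms. -/

namespace StateIC

open Finset Filter Topology

/-! ### Expectations with respect to finite product laws -/

section IidExp

variable {ι α : Type*} [Fintype ι] [DecidableEq ι] [Fintype α]

theorem sum_prod_apply (f : ι → α → ℝ) : ∑ c : ι → α, ∏ j, f j (c j) = ∏ j, ∑ a, f j a := by
  rw [Finset.prod_univ_sum, Fintype.piFinset_univ]

/-- The expectation of `F` when the coordinates are independent with mass function `p`. -/
noncomputable def iidExp (p : α → ℝ) (F : (ι → α) → ℝ) : ℝ := ∑ c, (∏ j, p (c j)) * F c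

theorem iidExp_add (p : α → ℝ) (F G : (ι → α) → ℝ) :
    iidExp p (fun c => F c + G c) = iidExp p F + iidExp p G := by
  simp only [iidExp, mul_add, sum_add_distrib]

theorem iidExp_mul_left (p : α → ℝ) (F : (ι → α) → ℝ) (a : ℝ) :
    iidExp p (fun c => a * F c) = a * iidExp p F := by
  simp only [iidExp, mul_sum]
  exact sum_congr rfl fun c _ => by ring

theorem iidExp_sum {κ : Type*} (T : Finset κ) (p : α → ℝ) (F : κ → (ι → α) → ℝ) :
    iidExp p (fun c => ∑ k ∈ T, F k c) = ∑ k ∈ T, iidExp p (F k) := by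
  simp only [iidExp, mul_sum]
  exact sum_comm

theorem iidExp_mono {p : α → ℝ} (hp : ∀ a, 0 ≤ p a) {F G : (ι → α) → ℝ} (h : ∀ c, F c ≤ G c) :
    iidExp p F ≤ iidExp p G :=
  sum_le_sum fun c _ => mul_le_mul_of_nonneg_left (h c) (prod_nonneg fun _ _ => hp _)

theorem iidExp_nonneg {p : α → ℝ} (hp : ∀ a, 0 ≤ p a) {F : (ι → α) → ℝ} (h : ∀ c, 0 ≤ F c) :
    0 ≤ iidExp p F :=
  sum_nonneg fun c _ => mul_nonneg (prod_nonneg fun _ _ => hp _) (h c)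

theorem iidExp_const {p : α → ℝ} (hp : ∑ a, p a = 1) (b : ℝ) :
    iidExp p (fun _ : ι → α => b) = b := by
  simp only [iidExp, ← sum_mul]
  rw [sum_prod_apply (fun _ : ι => p)]
  simp [hp]

/-- Isolating one coordinate is how independence enters: means of functions of one or two
coordinates become iterated sums. -/
theorem iidExp_split (p : α → ℝ) (F : (ι → α) → ℝ) (j : ι) :
    iidExp p F = ∑ a, p a * iidExp p (fun c : {i // i ≠ j} → α =>
      F ((Equiv.funSplitAt j α).symm (a, c))) := by
  unfold iidExp
  rw [← (Equiv.funSplitAt j α).symm.sum_comp, Fintype.sum_prod_type]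
  refine sum_congr rfl fun a _ => ?_
  rw [mul_sum]
  refine sum_congr rfl fun c _ => ?_
  rw [Fintype.prod_eq_mul_prod_subtype_ne _ j, ← mul_assoc]
  congr 2
  · simp [Equiv.funSplitAt, Equiv.piSplitAt]
  · refine prod_congr rfl fun i _ => ?_
    simp [Equiv.funSplitAt, Equiv.piSplitAt, i.2]

theorem iidExp_single {p : α → ℝ} (hp : ∑ a, p a = 1) (j : ι) (f : α → ℝ) :
    iidExp p (fun c : ι → α => f (c j)) = ∑ a, p a * f a := by
  rw [iidExp_split _ _ j]
  refine sum_congr rfl fun a _ => ?_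
  simp [Equiv.funSplitAt, Equiv.piSplitAt, iidExp_const hp]

theorem iidExp_pair {p : α → ℝ} (hp : ∑ a, p a = 1) {j k : ι} (hjk : k ≠ j) (f : α → α → ℝ) :
    iidExp p (fun c : ι → α => f (c j) (c k)) = ∑ a, p a * ∑ b, p b * f a b := by
  rw [iidExp_split _ _ j]
  refine sum_congr rfl fun a _ => ?_
  rw [← iidExp_single hp (⟨k, hjk⟩ : {i // i ≠ j}) (f a)]
  simp [Equiv.funSplitAt, Equiv.piSplitAt, hjk]

/-- In the expanded square every off-diagonal term contains the zero mean as a factor. The sum runs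
over a subset because a bin is only a part of the codebook. -/
theorem iidExp_sum_sq {p : α → ℝ} (hp : ∑ a, p a = 1) {f : α → ℝ} (hf : ∑ a, p a * f a = 0)
    (T : Finset ι) :
    iidExp p (fun c : ι → α => (∑ j ∈ T, f (c j)) ^ 2) = #T * ∑ a, p a * f a ^ 2 := by
  simp only [sq, sum_mul_sum]
  rw [iidExp_sum]
  simp only [iidExp_sum]
  have h : ∀ j ∈ T, ∑ k ∈ T, iidExp p (fun c : ι → α => f (c j) * f (c k)) =
      ∑ a, p a * (f a * f a) := by
    intro j hj
    rw [sum_eq_single j]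
    · exact iidExp_single hp j (fun a => f a * f a)
    · intro k _ hk
      rw [iidExp_pair hp hk (fun a b => f a * f b)]
      refine sum_eq_zero fun a _ => ?_
      have : ∑ b, p b * (f a * f b) = f a * ∑ b, p b * f b := by
        rw [mul_sum]; exact sum_congr rfl fun b _ => by ring
      rw [this, hf]; simp
    · exact fun h => absurd hj h
  rw [sum_congr rfl h]
  simp

end IidExp

/-! ### The weak law of large numbers -/

section WeakLaw

variable {α : Type*} [Fintype α]

/-- Chebyshev's inequality: the event forces the centred sum to deviate by at least n(m - x), and
its variance is nW. -/
theorem iidExp_sum_le_tendsto_zero {p : α → ℝ} (hp0 : ∀ a, 0 ≤ p a) (hp : ∑ a, p a = 1)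
    (f : α → ℝ) {x : ℝ} (hx : x < ∑ a, p a * f a) :
    Tendsto (fun n : ℕ => iidExp p (fun c : Fin n → α =>
      if ∑ j, f (c j) ≤ n * x then (1 : ℝ) else 0)) atTop (𝓝 0) := by
  set m := ∑ a, p a * f a with hm
  set W := ∑ a, p a * (f a - m) ^ 2 with hW
  have hd : 0 < m - x := sub_pos.2 hx
  have hcen : ∑ a, p a * (f a - m) = 0 := by
    simp only [mul_sub, sum_sub_distrib, ← sum_mul, hp]
    rw [← hm]; ring
  have hlim : Tendsto (fun n : ℕ => W / (m - x) ^ 2 * (1 / (n : ℝ))) atTop (𝓝 0) := by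
    simpa using (tendsto_one_div_atTop_nhds_zero_nat (𝕜 := ℝ)).const_mul (W / (m - x) ^ 2)
  refine squeeze_zero' (Eventually.of_forall fun n => iidExp_nonneg hp0 fun c => ?_) ?_ hlim
  · split_ifs <;> norm_num
  filter_upwards [eventually_gt_atTop 0] with n hn
  have hn' : (0 : ℝ) < n := by exact_mod_cast hn
  have hb : ∀ c : Fin n → α, (if ∑ j, f (c j) ≤ n * x then (1 : ℝ) else 0) ≤
      1 / (n * (m - x)) ^ 2 * (∑ j, (f (c j) - m)) ^ 2 := by
    intro c
    split_ifs with h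
    · rw [one_div_mul_eq_div, le_div_iff₀ (by positivity), one_mul]
      have h2 : ∑ j, (f (c j) - m) = ∑ j, f (c j) - n * m := by
        simp [sum_sub_distrib]
      rw [h2]
      have h3 : 0 ≤ n * (m - x) := by positivity
      nlinarith
    · positivity
  refine (iidExp_mono hp0 hb).trans ?_
  rw [iidExp_mul_left, iidExp_sum_sq hp hcen univ, card_univ, Fintype.card_fin, ← hW]
  apply le_of_eq
  field_simp

theorem two_rpow_lt_prod_iff {n : ℕ} {t : Fin n → ℝ} (ht : ∀ j, 0 < t j) (x : ℝ) :
    (2 : ℝ) ^ ((n : ℝ) * x) < ∏ j, t j ↔ n * x < ∑ j, Real.logb 2 (t j) := by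
  rw [← Real.logb_prod _ _ (fun j _ => (ht j).ne'),
    ← Real.lt_logb_iff_rpow_lt one_lt_two (prod_pos fun j _ => ht j)]

open Classical in
-- The weak law for the logarithms of `t`. Positivity is needed only on the support of `p`, since a
-- sequence that leaves the support has product mass zero.
theorem iidExp_prod_le_tendsto_zero {p : α → ℝ} (hp0 : ∀ a, 0 ≤ p a) (hp : ∑ a, p a = 1)
    {t : α → ℝ} (ht : ∀ a, p a ≠ 0 → 0 < t a) {x : ℝ}
    (hx : x < ∑ a, p a * Real.logb 2 (t a)) :
    Tendsto (fun n : ℕ => iidExp p (fun c : Fin n → α =>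
      if (2 : ℝ) ^ ((n : ℝ) * x) < ∏ j, t (c j) then (0 : ℝ) else 1)) atTop (𝓝 0) := by
  refine (iidExp_sum_le_tendsto_zero hp0 hp _ hx).congr fun n => sum_congr rfl fun c _ => ?_
  by_cases h : ∏ j, p (c j) = 0
  · simp [h]
  · have h' : ∀ j, 0 < t (c j) := fun j => ht _ (prod_ne_zero_iff.1 h j (mem_univ j))
    simp only [two_rpow_lt_prod_iff h' x, ← not_lt, ite_not]

open Classical in
-- The upper tail is the lower tail of the negated logarithms.
theorem iidExp_lt_prod_tendsto_zero {p : α → ℝ} (hp0 : ∀ a, 0 ≤ p a) (hp : ∑ a, p a = 1)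
    {t : α → ℝ} (ht : ∀ a, p a ≠ 0 → 0 < t a) {x : ℝ}
    (hx : ∑ a, p a * Real.logb 2 (t a) < x) :
    Tendsto (fun n : ℕ => iidExp p (fun c : Fin n → α =>
      if (2 : ℝ) ^ ((n : ℝ) * x) < ∏ j, t (c j) then (1 : ℝ) else 0)) atTop (𝓝 0) := by
  have hx' : -x < ∑ a, p a * (-Real.logb 2 (t a)) := by simpa using hx
  have hlim := iidExp_sum_le_tendsto_zero hp0 hp _ hx'
  refine squeeze_zero (fun n => iidExp_nonneg hp0 fun c => ?_) (fun n => ?_) hlim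
  · split_ifs <;> norm_num
  refine sum_le_sum fun c _ => ?_
  by_cases h : ∏ j, p (c j) = 0
  · simp [h]
  · have h' : ∀ j, 0 < t (c j) := fun j => ht _ (prod_ne_zero_iff.1 h j (mem_univ j))
    refine mul_le_mul_of_nonneg_left ?_ (prod_nonneg fun _ _ => hp0 _)
    simp only [two_rpow_lt_prod_iff h' x, sum_neg_distrib]
    split_ifs with h1 h2 <;> first | (exfalso; linarith) | norm_num

end WeakLaw

/-! ### Stochastic selection of a codeword in a bin -/

open Classical in
/-- The indicator of a proposition. -/
noncomputable def ind (P : Prop) : ℝ := if P then 1 else 0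

theorem ind_nonneg (P : Prop) : 0 ≤ ind P := by unfold ind; split_ifs <;> norm_num

theorem ind_le_one (P : Prop) : ind P ≤ 1 := by unfold ind; split_ifs <;> norm_num

theorem ind_of {P : Prop} (h : P) : ind P = 1 := if_pos h

theorem ind_of_not {P : Prop} (h : ¬P) : ind P = 0 := if_neg h

section Covering

variable {κ S U : Type*} [Fintype κ] [Fintype S]

/-- Selection of an index with probability proportional to its weight, renormalized so that
no index is selected with probability more than its weight over the number of indices. -/
noncomputable def binSelect (a : κ → ℝ) (k : κ) : ℝ := a k / max (∑ l, a l) (Fintype.card κ)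

theorem binSelect_nonneg {a : κ → ℝ} (ha : ∀ k, 0 ≤ a k) (k : κ) : 0 ≤ binSelect a k :=
  div_nonneg (ha k) (le_max_of_le_right (Nat.cast_nonneg _))

/-- The maximum in the normalization serves this bound. It involves only the weight of the selected
index, not the other codewords of the bin, so the independence of the codewords survives the
selection. -/
theorem binSelect_le [Nonempty κ] {a : κ → ℝ} (ha : ∀ k, 0 ≤ a k) (k : κ) :
    binSelect a k ≤ a k / Fintype.card κ :=
  div_le_div_of_nonneg_left (ha k) (by exact_mod_cast Fintype.card_pos) (le_max_right _ _)

theorem sum_binSelect_le_one [Nonempty κ] (a : κ → ℝ) : ∑ k, binSelect a k ≤ 1 := by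
  have hκ : (0 : ℝ) < Fintype.card κ := by exact_mod_cast Fintype.card_pos
  simp only [binSelect, ← sum_div]
  rw [div_le_one (lt_max_of_lt_right hκ)]
  exact le_max_left _ _

/-- Nothing is lost if the weights add up to at least the number of indices. Otherwise the loss is
one minus the average of `a`, hence at most one minus the average of `b`. The inequality x ≤ θ/2 +
x²/(2θ) makes the deviation of that average from `m` quadratic, ready for a variance bound. -/
theorem one_sub_sum_binSelect_le [Nonempty κ] {a b : κ → ℝ} (hb : ∀ k, b k ≤ a k) {m θ : ℝ}
    (hm : m ≤ 1) (hθ : 0 < θ) :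
    1 - ∑ k, binSelect a k ≤
      (1 - m) + θ / 2 + (∑ k, (b k - m)) ^ 2 / (2 * θ * Fintype.card κ ^ 2) := by
  have hκ : (0 : ℝ) < Fintype.card κ := by exact_mod_cast Fintype.card_pos
  set N : ℝ := (Fintype.card κ : ℝ) with hN
  have hsum : ∑ k, binSelect a k = (∑ k, a k) / max (∑ k, a k) N := by
    simp only [binSelect, ← sum_div, hN]
  have hba : ∑ k, b k ≤ ∑ k, a k := sum_le_sum fun k _ => hb k
  have hcen : ∑ k, (b k - m) = ∑ k, b k - N * m := by simp [sum_sub_distrib, hN]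
  rw [hsum, hcen]
  rcases le_total N (∑ k, a k) with h | h
  · rw [max_eq_left h, div_self (hκ.trans_le h).ne']
    have : 0 ≤ (∑ k, b k - N * m) ^ 2 / (2 * θ * N ^ 2) := by positivity
    linarith
  · rw [max_eq_right h]
    have h1 : (∑ k, b k) / N ≤ (∑ k, a k) / N := by gcongr
    have h2 : (∑ k, b k - N * m) ^ 2 / (2 * θ * N ^ 2) =
        (m - (∑ k, b k) / N) ^ 2 / (2 * θ) := by
      field_simp
      ring
    have h3 : m - (∑ k, b k) / N ≤ θ / 2 + (m - (∑ k, b k) / N) ^ 2 / (2 * θ) := by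
      set x := m - (∑ k, b k) / N
      have : θ / 2 + x ^ 2 / (2 * θ) - x = (θ - x) ^ 2 / (2 * θ) := by field_simp; ring
      have h4 : 0 ≤ (θ - x) ^ 2 / (2 * θ) := by positivity
      linarith
    rw [h2]
    linarith

/-- The law of `U` when `S` has mass function `μ` and `U` has conditional law `q` given `S`. -/
noncomputable def marginal (μ : S → ℝ) (q : S → U → ℝ) (u : U) : ℝ := ∑ s, μ s * q s u

/-- The density of the joint law with respect to the product of the marginals. -/
noncomputable def density (μ : S → ℝ) (q : S → U → ℝ) (s : S) (u : U) : ℝ :=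
  q s u / marginal μ q u

variable {μ : S → ℝ} {q : S → U → ℝ}

theorem marginal_nonneg (hμ : ∀ s, 0 ≤ μ s) (hq : ∀ s u, 0 ≤ q s u) (u : U) :
    0 ≤ marginal μ q u := sum_nonneg fun s _ => mul_nonneg (hμ s) (hq s u)

theorem sum_marginal [Fintype U] (hμ1 : ∑ s, μ s = 1) (hq1 : ∀ s, ∑ u, q s u = 1) :
    ∑ u, marginal μ q u = 1 := by
  unfold marginal
  rw [sum_comm]
  simp [← mul_sum, hq1, hμ1]

theorem density_nonneg (hμ : ∀ s, 0 ≤ μ s) (hq : ∀ s u, 0 ≤ q s u) (s : S) (u : U) :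
    0 ≤ density μ q s u := div_nonneg (hq s u) (marginal_nonneg hμ hq u)

/-- Strict inequality can occur only where the marginal vanishes: the quotient is then 0 by
convention, although `q s u` may be positive for a state without mass. -/
theorem marginal_mul_density_le (hq : ∀ s u, 0 ≤ q s u) (s : S) (u : U) :
    marginal μ q u * density μ q s u ≤ q s u := by
  unfold density
  by_cases h : marginal μ q u = 0
  · simp [h, hq]
  · rw [mul_div_cancel₀ _ h]

/-- The factor `μ s` restores equality, as a vanishing marginal forces every `μ s * q s u` to
vanish. -/
theorem mul_marginal_mul_density (hμ : ∀ s, 0 ≤ μ s) (hq : ∀ s u, 0 ≤ q s u) (s : S) (u : U) :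
    μ s * (marginal μ q u * density μ q s u) = μ s * q s u := by
  unfold density
  by_cases h : marginal μ q u = 0
  · have h1 := (sum_eq_zero_iff_of_nonneg fun s _ => mul_nonneg (hμ s) (hq s u)).1 h s
      (mem_univ s)
    simp [h, h1]
  · rw [mul_div_cancel₀ _ h]

variable [Fintype U] {ι : Type*} [Fintype ι] [DecidableEq ι]

/-- Second moment method. For the truncation b of `a` at `τ`, the variance is at most E b² ≤ Nθ² E b
≤ Nθ², where N is the bin size. The quadratic term therefore costs θ/2, and the other θ/2 is already
in the pointwise bound. -/
theorem iidExp_binSelect_deficit_le [Nonempty κ] {p : U → ℝ} (hp0 : ∀ u, 0 ≤ p u)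
    (hp : ∑ u, p u = 1) {a : U → ℝ} (ha : ∀ u, 0 ≤ a u) (hpa : ∑ u, p u * a u ≤ 1)
    {τ θ : ℝ} (hθ : 0 < θ) (hτ : τ ≤ Fintype.card κ * θ ^ 2) (e : κ ↪ ι) :
    iidExp p (fun c : ι → U => 1 - ∑ k, binSelect (fun l => a (c (e l))) k) ≤
      (1 - ∑ u, p u * (a u * ind (a u ≤ τ))) + θ := by
  have hκ : (0 : ℝ) < Fintype.card κ := by exact_mod_cast Fintype.card_pos
  set N : ℝ := (Fintype.card κ : ℝ) with hN
  set b : U → ℝ := fun u => a u * ind (a u ≤ τ) with hb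
  have hb0 : ∀ u, 0 ≤ b u := fun u => mul_nonneg (ha u) (ind_nonneg _)
  have hba : ∀ u, b u ≤ a u := fun u => mul_le_of_le_one_right (ha u) (ind_le_one _)
  set m := ∑ u, p u * b u with hm
  have hm0 : 0 ≤ m := sum_nonneg fun u _ => mul_nonneg (hp0 u) (hb0 u)
  have hm1 : m ≤ 1 :=
    (sum_le_sum fun u _ => mul_le_mul_of_nonneg_left (hba u) (hp0 u)).trans hpa
  have hcen : ∑ u, p u * (b u - m) = 0 := by
    simp only [mul_sub, sum_sub_distrib, ← sum_mul, hp]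
    rw [← hm]; ring
  have hvar : ∑ u, p u * (b u - m) ^ 2 ≤ N * θ ^ 2 := by
    have h1 : ∑ u, p u * (b u - m) ^ 2 = ∑ u, p u * b u ^ 2 - m ^ 2 := by
      have : ∀ u, p u * (b u - m) ^ 2 = p u * b u ^ 2 - 2 * m * (p u * b u) + m ^ 2 * p u :=
        fun u => by ring
      simp only [this, sum_add_distrib, sum_sub_distrib, ← mul_sum, hp]
      rw [← hm]; ring
    have h2 : ∀ u, p u * b u ^ 2 ≤ N * θ ^ 2 * (p u * b u) := by
      intro u
      by_cases h : a u ≤ τ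
      · have h3 : b u ≤ N * θ ^ 2 := (hba u).trans (h.trans hτ)
        have h4 := mul_nonneg (hp0 u) (hb0 u)
        nlinarith
      · simp [hb, ind_of_not h]
    have h3 : ∑ u, p u * b u ^ 2 ≤ N * θ ^ 2 * m := by
      rw [hm, mul_sum]; exact sum_le_sum fun u _ => h2 u
    have h4 : N * θ ^ 2 * m ≤ N * θ ^ 2 := mul_le_of_le_one_right (by positivity) hm1
    nlinarith [sq_nonneg m]
  refine (iidExp_mono hp0 (G := fun c => ((1 - m) + θ / 2) + 1 / (2 * θ * N ^ 2) *
    (∑ j ∈ univ.map e, (b (c j) - m)) ^ 2) fun c => ?_).trans ?_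
  · refine (one_sub_sum_binSelect_le (fun k => hba (c (e k))) hm1 hθ).trans (le_of_eq ?_)
    rw [sum_map]
    ring
  · rw [iidExp_add, iidExp_const hp, iidExp_mul_left, iidExp_sum_sq hp hcen, card_map, card_univ,
      ← hN]
    have : 1 / (2 * θ * N ^ 2) * (N * ∑ u, p u * (b u - m) ^ 2) ≤
        1 / (2 * θ * N ^ 2) * (N * (N * θ ^ 2)) := by gcongr
    have h2 : 1 / (2 * θ * N ^ 2) * (N * (N * θ ^ 2)) = θ / 2 := by field_simp
    linarith

/-- Averaged over the state, the mass removed by the truncation is the probability, under the joint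
law, that the density exceeds `τ`. -/
theorem sum_iidExp_binSelect_deficit_le [Nonempty κ] (hμ : ∀ s, 0 ≤ μ s)
    (hμ1 : ∑ s, μ s = 1) (hq : ∀ s u, 0 ≤ q s u) (hq1 : ∀ s, ∑ u, q s u = 1)
    {τ θ : ℝ} (hθ : 0 < θ) (hτ : τ ≤ Fintype.card κ * θ ^ 2) (e : κ ↪ ι) :
    ∑ s, μ s * iidExp (marginal μ q) (fun c : ι → U =>
      1 - ∑ k, binSelect (fun l => density μ q s (c (e l))) k) ≤
      ∑ s, ∑ u, μ s * q s u * ind (τ < density μ q s u) + θ := by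
  have h : ∀ s, μ s * iidExp (marginal μ q) (fun c : ι → U =>
      1 - ∑ k, binSelect (fun l => density μ q s (c (e l))) k) ≤
      ∑ u, μ s * q s u * ind (τ < density μ q s u) + μ s * θ := by
    intro s
    refine (mul_le_mul_of_nonneg_left (iidExp_binSelect_deficit_le (marginal_nonneg hμ hq)
      (sum_marginal hμ1 hq1) (density_nonneg hμ hq s) ?_ hθ hτ e) (hμ s)).trans (le_of_eq ?_)
    · rw [← hq1 s]
      exact sum_le_sum fun u _ => marginal_mul_density_le hq s u
    · rw [mul_add, mul_sub, mul_one]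
      congr 1
      have h1 : μ s = ∑ u, μ s * q s u := by rw [← mul_sum, hq1, mul_one]
      nth_rw 1 [h1]
      rw [mul_sum, ← sum_sub_distrib]
      refine sum_congr rfl fun u _ => ?_
      rw [← mul_assoc (marginal μ q u), ← mul_assoc (μ s), mul_marginal_mul_density hμ hq]
      by_cases h2 : density μ q s u ≤ τ
      · rw [ind_of h2, ind_of_not h2.not_gt]; ring
      · rw [ind_of_not h2, ind_of (not_le.1 h2)]; ring
  refine (sum_le_sum fun s _ => h s).trans (le_of_eq ?_)
  rw [sum_add_distrib, ← sum_mul, hμ1, one_mul]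

end Covering

/-! ### One-shot coding -/

/-- One use of an interference channel with state `S`, auxiliary variables `U` and `V` that are
conditionally independent given `S`, and stochastic channel inputs. The mass function `out`
of the outputs contains the mass of the state. -/
structure BinningModel (S U V X₁ X₂ Y₁ Y₂ : Type*) [Fintype S] [Fintype U] [Fintype V]
    [Fintype X₁] [Fintype X₂] [Fintype Y₁] [Fintype Y₂] where
  state : S → ℝ
  condU : S → U → ℝ
  condV : S → V → ℝ
  input₁ : S → U → X₁ → ℝ
  input₂ : S → V → X₂ → ℝ
  out : S → X₁ → X₂ → Y₁ → Y₂ → ℝ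
  condU_nonneg : ∀ s u, 0 ≤ condU s u
  condV_nonneg : ∀ s v, 0 ≤ condV s v
  input₁_nonneg : ∀ s u x, 0 ≤ input₁ s u x
  input₂_nonneg : ∀ s v x, 0 ≤ input₂ s v x
  out_nonneg : ∀ s x₁ x₂ y₁ y₂, 0 ≤ out s x₁ x₂ y₁ y₂
  sum_state : ∑ s, state s = 1
  sum_condU : ∀ s, ∑ u, condU s u = 1
  sum_condV : ∀ s, ∑ v, condV s v = 1
  sum_input₁ : ∀ s u, ∑ x, input₁ s u x = 1
  sum_input₂ : ∀ s v, ∑ x, input₂ s v x = 1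
  sum_out : ∀ s x₁ x₂, ∑ y₁, ∑ y₂, out s x₁ x₂ y₁ y₂ = state s

/-- A minimizer of `f` works; the mass missing from `q` is charged at the worst value `B`. -/
theorem exists_le_subconvex {X : Type*} [Fintype X] [Nonempty X] {q : X → ℝ}
    (hq : ∀ x, 0 ≤ q x) (hq1 : ∑ x, q x ≤ 1) {f : X → ℝ} {B : ℝ} (hf : ∀ x, f x ≤ B) :
    ∃ x, f x ≤ ∑ x, q x * f x + (1 - ∑ x, q x) * B := by
  obtain ⟨x₀, -, h⟩ := exists_min_image univ f univ_nonempty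
  refine ⟨x₀, ?_⟩
  have h1 : ∑ x, q x * f x₀ ≤ ∑ x, q x * f x :=
    sum_le_sum fun x hx => mul_le_mul_of_nonneg_left (h x hx) (hq x)
  have h2 : (1 - ∑ x, q x) * f x₀ ≤ (1 - ∑ x, q x) * B :=
    mul_le_mul_of_nonneg_left (hf x₀) (by linarith)
  rw [← sum_mul] at h1
  linarith

/-- The value of an encoder may be optimized separately for each message and state, as the total
cost is a sum over them. The first encoder is fixed against the randomized second one, with the cost
summed over `w₂`; then the second is fixed against the first. -/
theorem exists_deterministic_encoders {W₁ W₂ S X₁ X₂ : Type*} [Fintype W₁] [Fintype W₂]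
    [Fintype S] [Fintype X₁] [Fintype X₂] [Nonempty X₁] [Nonempty X₂]
    {Q₁ : W₁ → S → X₁ → ℝ} {Q₂ : W₂ → S → X₂ → ℝ}
    (hQ₁ : ∀ w s x, 0 ≤ Q₁ w s x) (hQ₂ : ∀ w s x, 0 ≤ Q₂ w s x)
    (hQ₁' : ∀ w s, ∑ x, Q₁ w s x ≤ 1) (hQ₂' : ∀ w s, ∑ x, Q₂ w s x ≤ 1)
    {μ : S → ℝ} {F : W₁ → W₂ → S → X₁ → X₂ → ℝ}
    (hF0 : ∀ w₁ w₂ s x₁ x₂, 0 ≤ F w₁ w₂ s x₁ x₂)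
    (hF : ∀ w₁ w₂ s x₁ x₂, F w₁ w₂ s x₁ x₂ ≤ μ s) :
    ∃ (e₁ : W₁ → S → X₁) (e₂ : W₂ → S → X₂),
      ∑ w₁, ∑ w₂, ∑ s, F w₁ w₂ s (e₁ w₁ s) (e₂ w₂ s) ≤
        ∑ w₁, ∑ w₂, ∑ s, (∑ x₁, ∑ x₂, Q₁ w₁ s x₁ * Q₂ w₂ s x₂ * F w₁ w₂ s x₁ x₂ +
          μ s * (1 - ∑ x, Q₁ w₁ s x) + μ s * (1 - ∑ x, Q₂ w₂ s x)) := by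
  have h1 : ∀ w₁ s, ∃ x₁, ∑ w₂, ∑ x₂, Q₂ w₂ s x₂ * F w₁ w₂ s x₁ x₂ ≤
      ∑ x₁, Q₁ w₁ s x₁ * (∑ w₂, ∑ x₂, Q₂ w₂ s x₂ * F w₁ w₂ s x₁ x₂) +
        (1 - ∑ x, Q₁ w₁ s x) * ∑ _w₂ : W₂, μ s := by
    intro w₁ s
    refine exists_le_subconvex (hQ₁ w₁ s) (hQ₁' w₁ s) fun x₁ => sum_le_sum fun w₂ _ => ?_
    have hμ : 0 ≤ μ s := (hF0 w₁ w₂ s x₁ (Classical.arbitrary X₂)).trans (hF _ _ _ _ _)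
    calc ∑ x₂, Q₂ w₂ s x₂ * F w₁ w₂ s x₁ x₂ ≤ ∑ x₂, Q₂ w₂ s x₂ * μ s :=
          sum_le_sum fun x₂ _ => mul_le_mul_of_nonneg_left (hF _ _ _ _ _) (hQ₂ _ _ _)
      _ ≤ μ s := by
          rw [← sum_mul]; exact mul_le_of_le_one_left hμ (hQ₂' w₂ s)
  choose e₁ he₁ using h1
  have h2 : ∀ w₂ s, ∃ x₂, ∑ w₁, F w₁ w₂ s (e₁ w₁ s) x₂ ≤
      ∑ x₂, Q₂ w₂ s x₂ * (∑ w₁, F w₁ w₂ s (e₁ w₁ s) x₂) +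
        (1 - ∑ x, Q₂ w₂ s x) * ∑ _w₁ : W₁, μ s := fun w₂ s =>
    exists_le_subconvex (hQ₂ w₂ s) (hQ₂' w₂ s) fun x₂ => sum_le_sum fun w₁ _ => hF _ _ _ _ _
  choose e₂ he₂ using h2
  refine ⟨e₁, e₂, ?_⟩
  have step2 : ∑ w₁, ∑ w₂, ∑ s, F w₁ w₂ s (e₁ w₁ s) (e₂ w₂ s) ≤
      ∑ w₁, ∑ s, ∑ w₂, ∑ x₂, Q₂ w₂ s x₂ * F w₁ w₂ s (e₁ w₁ s) x₂ +
        ∑ w₁ : W₁, ∑ w₂, ∑ s, μ s * (1 - ∑ x, Q₂ w₂ s x) := by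
    calc ∑ w₁, ∑ w₂, ∑ s, F w₁ w₂ s (e₁ w₁ s) (e₂ w₂ s)
        = ∑ w₂, ∑ s, ∑ w₁, F w₁ w₂ s (e₁ w₁ s) (e₂ w₂ s) := by
          rw [sum_comm]; exact sum_congr rfl fun _ _ => sum_comm
      _ ≤ ∑ w₂, ∑ s, (∑ x₂, Q₂ w₂ s x₂ * (∑ w₁, F w₁ w₂ s (e₁ w₁ s) x₂) +
            (1 - ∑ x, Q₂ w₂ s x) * ∑ _w₁ : W₁, μ s) :=
          sum_le_sum fun w₂ _ => sum_le_sum fun s _ => he₂ w₂ s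
      _ = _ := by
          simp only [sum_add_distrib, mul_sum]
          congr 1
          · rw [sum_comm, sum_comm (s := (univ : Finset W₁))]
            refine sum_congr rfl fun s _ => ?_
            rw [sum_comm (s := (univ : Finset W₁))]
            exact sum_congr rfl fun w₂ _ => sum_comm
          · rw [sum_comm (s := (univ : Finset W₁))]
            refine sum_congr rfl fun w₂ _ => ?_
            rw [sum_comm]
            exact sum_congr rfl fun _ _ => sum_congr rfl fun _ _ => mul_comm _ _
  have step1 : ∑ w₁, ∑ s, ∑ w₂, ∑ x₂, Q₂ w₂ s x₂ * F w₁ w₂ s (e₁ w₁ s) x₂ ≤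
      ∑ w₁, ∑ w₂, ∑ s, ∑ x₁, ∑ x₂, Q₁ w₁ s x₁ * Q₂ w₂ s x₂ * F w₁ w₂ s x₁ x₂ +
        ∑ w₁, ∑ w₂ : W₂, ∑ s, μ s * (1 - ∑ x, Q₁ w₁ s x) := by
    refine (sum_le_sum fun w₁ _ => sum_le_sum fun s _ => he₁ w₁ s).trans (le_of_eq ?_)
    simp only [sum_add_distrib, mul_sum]
    congr 1
    · refine sum_congr rfl fun w₁ _ => ?_
      rw [sum_comm (s := (univ : Finset W₂))]
      refine sum_congr rfl fun s _ => ?_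
      rw [sum_comm]
      exact sum_congr rfl fun _ _ => sum_congr rfl fun _ _ => sum_congr rfl fun _ _ => by ring
    · refine sum_congr rfl fun w₁ _ => ?_
      rw [sum_comm]
      exact sum_congr rfl fun _ _ => sum_congr rfl fun _ _ => mul_comm _ _
  refine (step2.trans (add_le_add_left step1 _)).trans (le_of_eq ?_)
  simp only [sum_add_distrib]

theorem exists_decoder {W Y : Type*} [Nonempty W] (T : W → Y → Prop) :
    ∃ d : Y → W, ∀ w y, T w y → (∀ w', w' ≠ w → ¬T w' y) → d y = w := by
  classical
  refine ⟨fun y => if h : ∃ w, T w y then h.choose else Classical.arbitrary W, ?_⟩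
  intro w y hw hu
  have h : ∃ w, T w y := ⟨w, hw⟩
  simp only [h, dif_pos]
  by_contra hne
  exact hu _ hne h.choose_spec

theorem nonempty_of_sum_eq_one {α : Type*} [Fintype α] {p : α → ℝ} (hp : ∑ a, p a = 1) :
    Nonempty α := by
  by_contra h
  rw [not_nonempty_iff] at h
  simp at hp

theorem exists_le_iidExp {ι α : Type*} [Fintype ι] [DecidableEq ι] [Fintype α] {p : α → ℝ}
    (hp0 : ∀ a, 0 ≤ p a) (hp : ∑ a, p a = 1) (F : (ι → α) → ℝ) : ∃ c, F c ≤ iidExp p F := by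
  have : Nonempty α := nonempty_of_sum_eq_one hp
  obtain ⟨c, -, h⟩ := exists_min_image univ F univ_nonempty
  refine ⟨c, ?_⟩
  have := iidExp_mono hp0 (F := fun _ => F c) fun c' => h c' (mem_univ c')
  rwa [iidExp_const hp] at this

namespace BinningModel

variable {S U V X₁ X₂ Y₁ Y₂ : Type*} [Fintype S] [Fintype U] [Fintype V]
    [Fintype X₁] [Fintype X₂] [Fintype Y₁] [Fintype Y₂] (M : BinningModel S U V X₁ X₂ Y₁ Y₂)

/-- The average error probability of a code for a single use of the channel. -/
noncomputable def errorProb {W₁ W₂ : Type*} [Fintype W₁] [Fintype W₂] (e₁ : W₁ → S → X₁)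
    (e₂ : W₂ → S → X₂) (d₁ : Y₁ → W₁) (d₂ : Y₂ → W₂) : ℝ :=
  1 / ((Fintype.card W₁ : ℝ) * Fintype.card W₂) * ∑ w₁, ∑ w₂, ∑ s, ∑ y₁, ∑ y₂,
    ind ((d₁ y₁, d₂ y₂) ≠ (w₁, w₂)) * M.out s (e₁ w₁ s) (e₂ w₂ s) y₁ y₂

/-- The mass function of the state and the outputs, given the auxiliary variables. -/
noncomputable def kernel (s : S) (u : U) (v : V) (y₁ : Y₁) (y₂ : Y₂) : ℝ :=
  ∑ x₁, ∑ x₂, M.input₁ s u x₁ * M.input₂ s v x₂ * M.out s x₁ x₂ y₁ y₂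

/-- The joint mass function of the state, the auxiliary variables and the outputs. -/
noncomputable def joint (ω : S × U × V × Y₁ × Y₂) : ℝ :=
  M.condU ω.1 ω.2.1 * M.condV ω.1 ω.2.2.1 * M.kernel ω.1 ω.2.1 ω.2.2.1 ω.2.2.2.1 ω.2.2.2.2

noncomputable abbrev lawU (u : U) : ℝ := marginal M.state M.condU u
noncomputable abbrev lawV (v : V) : ℝ := marginal M.state M.condV v
noncomputable abbrev densityU (s : S) (u : U) : ℝ := density M.state M.condU s u
noncomputable abbrev densityV (s : S) (v : V) : ℝ := density M.state M.condV s v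

theorem kernel_nonneg (s : S) (u : U) (v : V) (y₁ : Y₁) (y₂ : Y₂) :
    0 ≤ M.kernel s u v y₁ y₂ :=
  sum_nonneg fun _ _ => sum_nonneg fun _ _ => mul_nonneg
    (mul_nonneg (M.input₁_nonneg _ _ _) (M.input₂_nonneg _ _ _)) (M.out_nonneg _ _ _ _ _)

theorem joint_nonneg (ω : S × U × V × Y₁ × Y₂) : 0 ≤ M.joint ω :=
  mul_nonneg (mul_nonneg (M.condU_nonneg _ _) (M.condV_nonneg _ _)) (M.kernel_nonneg _ _ _ _ _)

theorem nonempty_input₁ (M : BinningModel S U V X₁ X₂ Y₁ Y₂) : Nonempty X₁ := by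
  obtain ⟨s⟩ := nonempty_of_sum_eq_one M.sum_state
  obtain ⟨u⟩ := nonempty_of_sum_eq_one (M.sum_condU s)
  exact nonempty_of_sum_eq_one (M.sum_input₁ s u)

theorem nonempty_input₂ (M : BinningModel S U V X₁ X₂ Y₁ Y₂) : Nonempty X₂ := by
  obtain ⟨s⟩ := nonempty_of_sum_eq_one M.sum_state
  obtain ⟨v⟩ := nonempty_of_sum_eq_one (M.sum_condV s)
  exact nonempty_of_sum_eq_one (M.sum_input₂ s v)

theorem state_nonneg (s : S) : 0 ≤ M.state s := by
  obtain ⟨x₁⟩ := M.nonempty_input₁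
  obtain ⟨x₂⟩ := M.nonempty_input₂
  rw [← M.sum_out s x₁ x₂]
  exact sum_nonneg fun _ _ => sum_nonneg fun _ _ => M.out_nonneg _ _ _ _ _

theorem sum_kernel (s : S) (u : U) (v : V) :
    ∑ y₁, ∑ y₂, M.kernel s u v y₁ y₂ = M.state s := by
  unfold kernel
  calc ∑ y₁, ∑ y₂, ∑ x₁, ∑ x₂, M.input₁ s u x₁ * M.input₂ s v x₂ * M.out s x₁ x₂ y₁ y₂
      = ∑ x₁, ∑ x₂, ∑ y₁, ∑ y₂, M.input₁ s u x₁ * M.input₂ s v x₂ * M.out s x₁ x₂ y₁ y₂ := by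
        rw [sum_congr rfl fun y₁ _ => sum_comm, sum_comm]
        refine sum_congr rfl fun x₁ _ => ?_
        rw [sum_congr rfl fun y₁ _ => sum_comm, sum_comm]
    _ = _ := by
        simp only [← mul_sum, M.sum_out]
        simp only [← sum_mul, ← mul_sum, M.sum_input₁, M.sum_input₂, mul_one, one_mul]

theorem sum_joint : ∑ ω, M.joint ω = 1 := by
  simp only [Fintype.sum_prod_type, joint, ← mul_sum, M.sum_kernel]
  simp only [← sum_mul, ← mul_sum, M.sum_condU, M.sum_condV, one_mul, mul_one, M.sum_state]

/-- The mean of `f` over the state and the outputs for the codewords `u` and `v`, weighted by the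
densities of the codewords given the state. -/
noncomputable def weighted (f : U → V → Y₁ → Y₂ → ℝ) (u : U) (v : V) : ℝ :=
  ∑ s, M.densityU s u * M.densityV s v * ∑ y₁, ∑ y₂, M.kernel s u v y₁ y₂ * f u v y₁ y₂

/-- Expectation with respect to the joint law. -/
noncomputable def ex (f : U → V → Y₁ → Y₂ → ℝ) : ℝ :=
  ∑ ω, M.joint ω * f ω.2.1 ω.2.2.1 ω.2.2.2.1 ω.2.2.2.2

theorem ex_nonneg {f : U → V → Y₁ → Y₂ → ℝ} (hf : ∀ u v y₁ y₂, 0 ≤ f u v y₁ y₂) :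
    0 ≤ M.ex f := sum_nonneg fun _ _ => mul_nonneg (M.joint_nonneg _) (hf _ _ _ _)

theorem lawU_nonneg (u : U) : 0 ≤ M.lawU u := marginal_nonneg M.state_nonneg M.condU_nonneg u
theorem lawV_nonneg (v : V) : 0 ≤ M.lawV v := marginal_nonneg M.state_nonneg M.condV_nonneg v
theorem sum_lawU : ∑ u, M.lawU u = 1 := sum_marginal M.sum_state M.sum_condU
theorem sum_lawV : ∑ v, M.lawV v = 1 := sum_marginal M.sum_state M.sum_condV
theorem densityU_nonneg (s : S) (u : U) : 0 ≤ M.densityU s u :=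
  density_nonneg M.state_nonneg M.condU_nonneg s u
theorem densityV_nonneg (s : S) (v : V) : 0 ≤ M.densityV s v :=
  density_nonneg M.state_nonneg M.condV_nonneg s v

/-- A marginal times its density is at most the conditional law. Independent codewords reweighted by
their densities are thus dominated by the joint law, in which U and V are conditionally independent
given the state. -/
theorem sum_weighted_le {f : U → V → Y₁ → Y₂ → ℝ} (hf : ∀ u v y₁ y₂, 0 ≤ f u v y₁ y₂) :
    ∑ u, M.lawU u * ∑ v, M.lawV v * M.weighted f u v ≤ M.ex f := by
  have h : M.ex f = ∑ u, ∑ v, ∑ s, M.condU s u * M.condV s v *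
      ∑ y₁, ∑ y₂, M.kernel s u v y₁ y₂ * f u v y₁ y₂ := by
    unfold ex joint
    simp only [Fintype.sum_prod_type, mul_sum]
    rw [sum_comm]
    refine sum_congr rfl fun u _ => ?_
    rw [sum_comm]
    exact sum_congr rfl fun v _ => sum_congr rfl fun s _ => sum_congr rfl fun y₁ _ =>
      sum_congr rfl fun y₂ _ => by ring
  rw [h]
  refine sum_le_sum fun u _ => ?_
  rw [mul_sum]
  refine sum_le_sum fun v _ => ?_
  unfold weighted
  rw [mul_sum, mul_sum]
  refine sum_le_sum fun s _ => ?_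
  have hg : 0 ≤ ∑ y₁, ∑ y₂, M.kernel s u v y₁ y₂ * f u v y₁ y₂ :=
    sum_nonneg fun _ _ => sum_nonneg fun _ _ => mul_nonneg (M.kernel_nonneg _ _ _ _ _) (hf _ _ _ _)
  have h1 := marginal_mul_density_le (μ := M.state) M.condU_nonneg s u
  have h2 := marginal_mul_density_le (μ := M.state) M.condV_nonneg s v
  calc _ = (M.lawU u * M.densityU s u) * (M.lawV v * M.densityV s v) *
        ∑ y₁, ∑ y₂, M.kernel s u v y₁ y₂ * f u v y₁ y₂ := by ring
    _ ≤ _ := mul_le_mul_of_nonneg_right (mul_le_mul h1 h2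
        (mul_nonneg (M.lawV_nonneg v) (M.densityV_nonneg s v)) (M.condU_nonneg s u)) hg

/-! ### Codewords independent of the transmitted pair -/

section Packing

variable {ι₁ ι₂ : Type*} [Fintype ι₁] [DecidableEq ι₁] [Fintype ι₂] [DecidableEq ι₂]

theorem iidExp_weighted_le {f : U → V → Y₁ → Y₂ → ℝ} (hf : ∀ u v y₁ y₂, 0 ≤ f u v y₁ y₂)
    (j : ι₁) (m : ι₂) :
    iidExp M.lawU (fun cu : ι₁ → U => iidExp M.lawV (fun cv : ι₂ → V =>
      M.weighted f (cu j) (cv m))) ≤ M.ex f := by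
  refine le_of_eq_of_le ?_ (M.sum_weighted_le hf)
  rw [← iidExp_single M.sum_lawU j]
  congr 1
  ext cu
  exact iidExp_single M.sum_lawV m (fun v => M.weighted f (cu j) v)

/-- The weights involve only the codewords `j` and `m`, so the codeword `j'` is averaged separately
under its own law. -/
theorem iidExp_weighted_left_le {f : U → U → V → Y₁ → Y₂ → ℝ}
    (hf : ∀ u' u v y₁ y₂, 0 ≤ f u' u v y₁ y₂) {j j' : ι₁} (hj : j' ≠ j) (m : ι₂) :
    iidExp M.lawU (fun cu : ι₁ → U => iidExp M.lawV (fun cv : ι₂ → V =>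
      M.weighted (f (cu j')) (cu j) (cv m))) ≤ ∑ u', M.lawU u' * M.ex (f u') := by
  have h : iidExp M.lawU (fun cu : ι₁ → U => iidExp M.lawV (fun cv : ι₂ → V =>
      M.weighted (f (cu j')) (cu j) (cv m))) = ∑ u', M.lawU u' *
        ∑ u, M.lawU u * ∑ v, M.lawV v * M.weighted (f u') u v := by
    rw [← iidExp_pair M.sum_lawU hj.symm (fun u' u => ∑ v, M.lawV v * M.weighted (f u') u v)]
    congr 1
    ext cu
    exact iidExp_single M.sum_lawV m (fun v => M.weighted (f (cu j')) (cu j) v)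
  rw [h]
  exact sum_le_sum fun u' _ =>
    mul_le_mul_of_nonneg_left (M.sum_weighted_le (hf u')) (M.lawU_nonneg u')

theorem iidExp_weighted_right_le {f : V → U → V → Y₁ → Y₂ → ℝ}
    (hf : ∀ v' u v y₁ y₂, 0 ≤ f v' u v y₁ y₂) (j : ι₁) {m m' : ι₂} (hm : m' ≠ m) :
    iidExp M.lawU (fun cu : ι₁ → U => iidExp M.lawV (fun cv : ι₂ → V =>
      M.weighted (f (cv m')) (cu j) (cv m))) ≤ ∑ v', M.lawV v' * M.ex (f v') := by
  have h : iidExp M.lawU (fun cu : ι₁ → U => iidExp M.lawV (fun cv : ι₂ → V =>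
      M.weighted (f (cv m')) (cu j) (cv m))) = ∑ v', M.lawV v' *
        ∑ u, M.lawU u * ∑ v, M.lawV v * M.weighted (f v') u v := by
    calc _ = iidExp M.lawU (fun cu : ι₁ → U => ∑ v', M.lawV v' *
          ∑ v, M.lawV v * M.weighted (f v') (cu j) v) := by
          congr 1
          ext cu
          exact iidExp_pair M.sum_lawV hm.symm (fun v' v => M.weighted (f v') (cu j) v)
      _ = _ := by
          rw [iidExp_sum]
          refine sum_congr rfl fun v' _ => ?_
          rw [iidExp_mul_left, iidExp_single M.sum_lawU j
            (fun u => ∑ v, M.lawV v * M.weighted (f v') u v)]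
  rw [h]
  exact sum_le_sum fun v' _ =>
    mul_le_mul_of_nonneg_left (M.sum_weighted_le (hf v')) (M.lawV_nonneg v')

theorem iidExp_weighted_both_le {f : U → V → U → V → Y₁ → Y₂ → ℝ}
    (hf : ∀ u' v' u v y₁ y₂, 0 ≤ f u' v' u v y₁ y₂) {j j' : ι₁} (hj : j' ≠ j)
    {m m' : ι₂} (hm : m' ≠ m) :
    iidExp M.lawU (fun cu : ι₁ → U => iidExp M.lawV (fun cv : ι₂ → V =>
      M.weighted (f (cu j') (cv m')) (cu j) (cv m))) ≤
      ∑ u', M.lawU u' * ∑ v', M.lawV v' * M.ex (f u' v') := by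
  have h : iidExp M.lawU (fun cu : ι₁ → U => iidExp M.lawV (fun cv : ι₂ → V =>
      M.weighted (f (cu j') (cv m')) (cu j) (cv m))) = ∑ u', M.lawU u' *
        ∑ v', M.lawV v' * ∑ u, M.lawU u * ∑ v, M.lawV v * M.weighted (f u' v') u v := by
    calc _ = iidExp M.lawU (fun cu : ι₁ → U => ∑ v', M.lawV v' *
          ∑ v, M.lawV v * M.weighted (f (cu j') v') (cu j) v) := by
          congr 1
          ext cu
          exact iidExp_pair M.sum_lawV hm.symm (fun v' v => M.weighted (f (cu j') v') (cu j) v)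
      _ = _ := by
          rw [iidExp_pair M.sum_lawU hj.symm (fun u' u => ∑ v', M.lawV v' *
            ∑ v, M.lawV v * M.weighted (f u' v') u v)]
          refine sum_congr rfl fun u' _ => ?_
          congr 1
          simp only [mul_sum]
          rw [sum_comm]
          exact sum_congr rfl fun _ _ => sum_congr rfl fun _ _ => sum_congr rfl fun _ _ => by ring
  rw [h]
  exact sum_le_sum fun u' _ => mul_le_mul_of_nonneg_left (sum_le_sum fun v' _ =>
    mul_le_mul_of_nonneg_left (M.sum_weighted_le (hf u' v')) (M.lawV_nonneg v')) (M.lawU_nonneg u')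

end Packing

end BinningModel

/-! ### Decoders based on tests, with a pointwise union bound -/

section Decoding

variable {U V Y₁ Y₂ W₁ W₂ κ₁ κ₂ : Type*} [Fintype W₁] [DecidableEq W₁] [Fintype W₂]
  [DecidableEq W₂] [Fintype κ₁] [Fintype κ₂] [DecidableEq κ₂]
  (A : U → V → Y₁ → Prop) (C : V → Y₂ → Prop)

/-- The number of the ways in which a decoder that relies on the tests `A` and `C` may fail
to recover the messages of the codewords with indices `j` and `m`. -/
noncomputable def failures (cu : W₁ × κ₁ → U) (cv : W₂ × κ₂ → V) (j : W₁ × κ₁) (m : W₂ × κ₂)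
    (u : U) (v : V) (y₁ : Y₁) (y₂ : Y₂) : ℝ :=
  ind (¬A u v y₁) + ind (¬C v y₂) +
    (∑ w ∈ univ.erase j.1, ∑ k, ind (A (cu (w, k)) v y₁) +
      ∑ w ∈ univ.erase j.1, ∑ k, ∑ m' ∈ univ.erase m, ind (A (cu (w, k)) (cv m') y₁)) +
    ∑ w ∈ univ.erase m.1, ∑ k, ind (C (cv (w, k)) y₂)

/-- The first decoder accepts a message if a codeword of its bin passes with any codeword of the
whole second codebook; it does not recover the second message. If the true codewords pass and no
false message is accepted, both decoders are right; otherwise one of the counts is at least one. -/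
theorem exists_decoders [Nonempty W₁] [Nonempty W₂] (cu : W₁ × κ₁ → U) (cv : W₂ × κ₂ → V) :
    ∃ (d₁ : Y₁ → W₁) (d₂ : Y₂ → W₂), ∀ j m y₁ y₂,
      ind ((d₁ y₁, d₂ y₂) ≠ (j.1, m.1)) ≤ failures A C cu cv j m (cu j) (cv m) y₁ y₂ := by
  obtain ⟨d₁, hd₁⟩ := exists_decoder fun (w : W₁) (y : Y₁) => ∃ k m, A (cu (w, k)) (cv m) y
  obtain ⟨d₂, hd₂⟩ := exists_decoder fun (w : W₂) (y : Y₂) => ∃ k, C (cv (w, k)) y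
  refine ⟨d₁, d₂, fun j m y₁ y₂ => ?_⟩
  have n1 : 0 ≤ ind (¬A (cu j) (cv m) y₁) := ind_nonneg _
  have n2 : 0 ≤ ind (¬C (cv m) y₂) := ind_nonneg _
  have n3 : 0 ≤ ∑ w ∈ univ.erase j.1, ∑ k, ind (A (cu (w, k)) (cv m) y₁) :=
    sum_nonneg fun _ _ => sum_nonneg fun _ _ => ind_nonneg _
  have n4 : 0 ≤ ∑ w ∈ univ.erase j.1, ∑ k, ∑ m' ∈ univ.erase m,
      ind (A (cu (w, k)) (cv m') y₁) :=
    sum_nonneg fun _ _ => sum_nonneg fun _ _ => sum_nonneg fun _ _ => ind_nonneg _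
  have n5 : 0 ≤ ∑ w ∈ univ.erase m.1, ∑ k, ind (C (cv (w, k)) y₂) :=
    sum_nonneg fun _ _ => sum_nonneg fun _ _ => ind_nonneg _
  unfold failures
  by_cases hA : A (cu j) (cv m) y₁
  swap
  · have := ind_le_one ((d₁ y₁, d₂ y₂) ≠ (j.1, m.1))
    rw [ind_of hA]; linarith
  by_cases hC : C (cv m) y₂
  swap
  · have := ind_le_one ((d₁ y₁, d₂ y₂) ≠ (j.1, m.1))
    rw [ind_of hC]; linarith
  by_cases h1 : ∃ w, w ≠ j.1 ∧ ∃ k m, A (cu (w, k)) (cv m) y₁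
  · obtain ⟨w, hw, k, m', h⟩ := h1
    have := ind_le_one ((d₁ y₁, d₂ y₂) ≠ (j.1, m.1))
    have hw' : w ∈ univ.erase j.1 := mem_erase.2 ⟨hw, mem_univ _⟩
    -- A false first codeword passes beside the true second codeword or beside another one. The two
    -- events have different probabilities and are counted apart.
    by_cases hm : m' = m
    · subst hm
      have h3 : 1 ≤ ∑ w ∈ univ.erase j.1, ∑ k, ind (A (cu (w, k)) (cv m') y₁) := by
        rw [← ind_of h]
        exact (single_le_sum (f := fun k => ind (A (cu (w, k)) (cv m') y₁))
          (fun _ _ => ind_nonneg _) (mem_univ k)).trans (single_le_sum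
          (f := fun w => ∑ k, ind (A (cu (w, k)) (cv m') y₁))
          (fun _ _ => sum_nonneg fun _ _ => ind_nonneg _) hw')
      linarith
    · have h4 : 1 ≤ ∑ w ∈ univ.erase j.1, ∑ k, ∑ m' ∈ univ.erase m,
          ind (A (cu (w, k)) (cv m') y₁) := by
        rw [← ind_of h]
        refine (single_le_sum (f := fun m' => ind (A (cu (w, k)) (cv m') y₁))
          (fun _ _ => ind_nonneg _) (mem_erase.2 ⟨hm, mem_univ m'⟩)).trans ?_
        refine (single_le_sum (f := fun k => ∑ m' ∈ univ.erase m, ind (A (cu (w, k)) (cv m') y₁))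
          (fun _ _ => sum_nonneg fun _ _ => ind_nonneg _) (mem_univ k)).trans ?_
        exact single_le_sum
          (f := fun w => ∑ k, ∑ m' ∈ univ.erase m, ind (A (cu (w, k)) (cv m') y₁))
          (fun _ _ => sum_nonneg fun _ _ => sum_nonneg fun _ _ => ind_nonneg _) hw'
      linarith
  by_cases h2 : ∃ w, w ≠ m.1 ∧ ∃ k, C (cv (w, k)) y₂
  · obtain ⟨w, hw, k, h⟩ := h2
    have := ind_le_one ((d₁ y₁, d₂ y₂) ≠ (j.1, m.1))
    have hw' : w ∈ univ.erase m.1 := mem_erase.2 ⟨hw, mem_univ _⟩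
    have h3 : 1 ≤ ∑ w ∈ univ.erase m.1, ∑ k, ind (C (cv (w, k)) y₂) := by
      rw [← ind_of h]
      exact (single_le_sum (f := fun k => ind (C (cv (w, k)) y₂))
        (fun _ _ => ind_nonneg _) (mem_univ k)).trans (single_le_sum
        (f := fun w => ∑ k, ind (C (cv (w, k)) y₂))
        (fun _ _ => sum_nonneg fun _ _ => ind_nonneg _) hw')
    linarith
  have e1 : d₁ y₁ = j.1 := hd₁ _ _ ⟨j.2, m, hA⟩ fun w hw hT => h1 ⟨w, hw, hT⟩
  have e2 : d₂ y₂ = m.1 := hd₂ _ _ ⟨m.2, hC⟩ fun w hw hT => h2 ⟨w, hw, hT⟩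
  rw [ind_of_not (by simp [e1, e2])]
  linarith

end Decoding

namespace BinningModel

variable {S U V X₁ X₂ Y₁ Y₂ : Type*} [Fintype S] [Fintype U] [Fintype V]
    [Fintype X₁] [Fintype X₂] [Fintype Y₁] [Fintype Y₂] (M : BinningModel S U V X₁ X₂ Y₁ Y₂)

theorem weighted_add (f g : U → V → Y₁ → Y₂ → ℝ) (u : U) (v : V) :
    M.weighted (fun u v y₁ y₂ => f u v y₁ y₂ + g u v y₁ y₂) u v =
      M.weighted f u v + M.weighted g u v := by
  simp only [weighted, mul_add, sum_add_distrib]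

theorem weighted_sum {κ : Type*} (T : Finset κ) (f : κ → U → V → Y₁ → Y₂ → ℝ) (u : U) (v : V) :
    M.weighted (fun u v y₁ y₂ => ∑ k ∈ T, f k u v y₁ y₂) u v =
      ∑ k ∈ T, M.weighted (f k) u v := by
  simp only [weighted, mul_sum]
  rw [sum_comm (s := T)]
  refine sum_congr rfl fun s _ => ?_
  rw [sum_comm (s := T)]
  refine sum_congr rfl fun y₁ _ => ?_
  rw [sum_comm (s := T)]

/-! ### Random codebooks -/

section RandomCoding

variable {W₁ W₂ κ₁ κ₂ : Type*} [Fintype W₁] [DecidableEq W₁] [Fintype W₂] [DecidableEq W₂]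
  [Fintype κ₁] [Fintype κ₂] [DecidableEq κ₂]
  (A : U → V → Y₁ → Prop) (C : V → Y₂ → Prop)

/-- The bound on the expected number of failures that results from independent codewords. -/
noncomputable def failureBound (N₁ N₂ L K : ℝ) : ℝ :=
  M.ex (fun u v y₁ _ => ind (¬A u v y₁)) + M.ex (fun _ v _ y₂ => ind (¬C v y₂)) +
    ((N₁ - 1) * L * ∑ u', M.lawU u' * M.ex (fun _ v y₁ _ => ind (A u' v y₁)) +
      (N₁ - 1) * L * (N₂ * K) *
        ∑ u', M.lawU u' * ∑ v', M.lawV v' * M.ex (fun _ _ y₁ _ => ind (A u' v' y₁))) +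
    (N₂ - 1) * K * ∑ v', M.lawV v' * M.ex (fun _ _ _ y₂ => ind (C v' y₂))

/-- The mean probability that the selection of a codeword in the bin of a message fails. -/
noncomputable def deficit {T : Type*} [Fintype T] {W κ : Type*} [Fintype κ] (q : S → T → ℝ)
    (c : W × κ → T) (w : W) : ℝ :=
  ∑ s, M.state s * (1 - ∑ k, binSelect (fun l => density M.state q s (c (w, l))) k)

theorem iidExp_deficit_le {T : Type*} [Fintype T] {q : S → T → ℝ} {W κ : Type*} [Fintype W]
    [DecidableEq W] [Fintype κ] [DecidableEq κ] [Nonempty κ]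
    (hq : ∀ s t, 0 ≤ q s t) (hq1 : ∀ s, ∑ t, q s t = 1) {τ θ : ℝ} (hθ : 0 < θ)
    (hτ : τ ≤ Fintype.card κ * θ ^ 2) (w : W) :
    iidExp (marginal M.state q) (fun c : W × κ → T => M.deficit q c w) ≤
      ∑ s, ∑ t, M.state s * q s t * ind (τ < density M.state q s t) + θ := by
  unfold deficit
  simp only [iidExp_sum, iidExp_mul_left]
  exact sum_iidExp_binSelect_deficit_le M.state_nonneg M.sum_state hq hq1 hθ hτ
    (⟨fun l => (w, l), fun a b h => (Prod.mk.inj h).2⟩ : κ ↪ W × κ)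

/-- Each randomized encoder selects an index in its bin and then draws the input. The cap on the
selection probabilities turns the error into means of `weighted`, and the missing selection mass
goes into `deficit`. -/
theorem exists_code_of_codebooks [Nonempty W₁] [Nonempty W₂] [Nonempty κ₁] [Nonempty κ₂]
    (cu : W₁ × κ₁ → U) (cv : W₂ × κ₂ → V) :
    ∃ (e₁ : W₁ → S → X₁) (e₂ : W₂ → S → X₂) (d₁ : Y₁ → W₁) (d₂ : Y₂ → W₂),
      M.errorProb e₁ e₂ d₁ d₂ ≤ 1 / ((Fintype.card W₁ : ℝ) * Fintype.card W₂) *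
        ∑ w₁, ∑ w₂, (∑ k₁, ∑ k₂, 1 / ((Fintype.card κ₁ : ℝ) * Fintype.card κ₂) *
          M.weighted (failures A C cu cv (w₁, k₁) (w₂, k₂)) (cu (w₁, k₁)) (cv (w₂, k₂)) +
          M.deficit M.condU cu w₁ + M.deficit M.condV cv w₂) := by
  obtain ⟨d₁, d₂, hd⟩ := exists_decoders A C cu cv
  have := M.nonempty_input₁
  have := M.nonempty_input₂
  set bU : W₁ → S → κ₁ → ℝ := fun w s => binSelect (fun l => M.densityU s (cu (w, l))) with hbU
  set bV : W₂ → S → κ₂ → ℝ := fun w s => binSelect (fun l => M.densityV s (cv (w, l))) with hbV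
  have bU0 : ∀ w s k, 0 ≤ bU w s k := fun w s => binSelect_nonneg fun _ => M.densityU_nonneg _ _
  have bV0 : ∀ w s k, 0 ≤ bV w s k := fun w s => binSelect_nonneg fun _ => M.densityV_nonneg _ _
  have hsumU : ∀ w s, ∑ x, ∑ k, bU w s k * M.input₁ s (cu (w, k)) x = ∑ k, bU w s k := by
    intro w s
    rw [sum_comm]
    simp only [← mul_sum, M.sum_input₁, mul_one]
  have hsumV : ∀ w s, ∑ x, ∑ k, bV w s k * M.input₂ s (cv (w, k)) x = ∑ k, bV w s k := by
    intro w s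
    rw [sum_comm]
    simp only [← mul_sum, M.sum_input₂, mul_one]
  obtain ⟨e₁, e₂, he⟩ := exists_deterministic_encoders (μ := M.state)
    (Q₁ := fun w s x => ∑ k, bU w s k * M.input₁ s (cu (w, k)) x)
    (Q₂ := fun w s x => ∑ k, bV w s k * M.input₂ s (cv (w, k)) x)
    (F := fun w₁ w₂ s x₁ x₂ => ∑ y₁, ∑ y₂, ind ((d₁ y₁, d₂ y₂) ≠ (w₁, w₂)) *
      M.out s x₁ x₂ y₁ y₂)
    (fun w s x => sum_nonneg fun k _ => mul_nonneg (bU0 _ _ _) (M.input₁_nonneg _ _ _))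
    (fun w s x => sum_nonneg fun k _ => mul_nonneg (bV0 _ _ _) (M.input₂_nonneg _ _ _))
    (fun w s => by rw [hsumU]; exact sum_binSelect_le_one _)
    (fun w s => by rw [hsumV]; exact sum_binSelect_le_one _)
    (fun _ _ _ _ _ => sum_nonneg fun _ _ => sum_nonneg fun _ _ =>
      mul_nonneg (ind_nonneg _) (M.out_nonneg _ _ _ _ _))
    (fun w₁ w₂ s x₁ x₂ => by
      rw [← M.sum_out s x₁ x₂]
      exact sum_le_sum fun _ _ => sum_le_sum fun _ _ =>
        mul_le_of_le_one_left (M.out_nonneg _ _ _ _ _) (ind_le_one _))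
  refine ⟨e₁, e₂, d₁, d₂, ?_⟩
  unfold errorProb
  refine mul_le_mul_of_nonneg_left (he.trans ?_) (by positivity)
  refine sum_le_sum fun w₁ _ => sum_le_sum fun w₂ _ => ?_
  simp only [hsumU, hsumV, sum_add_distrib]
  refine add_le_add_left (add_le_add_left ?_ _) _
  -- Summing out the channel inputs leaves only the choice of the two indices, with `kernel` as the
  -- law of state and outputs.
  have hker : ∀ s, ∑ x₁, ∑ x₂, (∑ k, bU w₁ s k * M.input₁ s (cu (w₁, k)) x₁) *
      (∑ k, bV w₂ s k * M.input₂ s (cv (w₂, k)) x₂) *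
      (∑ y₁, ∑ y₂, ind ((d₁ y₁, d₂ y₂) ≠ (w₁, w₂)) * M.out s x₁ x₂ y₁ y₂) =
      ∑ k₁, ∑ k₂, bU w₁ s k₁ * bV w₂ s k₂ * ∑ y₁, ∑ y₂,
        M.kernel s (cu (w₁, k₁)) (cv (w₂, k₂)) y₁ y₂ * ind ((d₁ y₁, d₂ y₂) ≠ (w₁, w₂)) := by
    intro s
    simp only [kernel, mul_sum, sum_mul]
    have e1 : ∀ (f : X₁ → X₂ → Y₁ → Y₂ → κ₂ → κ₁ → ℝ),
        ∑ x₁, ∑ x₂, ∑ y₁, ∑ y₂, ∑ k₂, ∑ k₁, f x₁ x₂ y₁ y₂ k₂ k₁ =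
        ∑ k₁, ∑ k₂, ∑ y₁, ∑ y₂, ∑ x₁, ∑ x₂, f x₁ x₂ y₁ y₂ k₂ k₁ := by
      intro f
      have h := Fintype.sum_equiv
        (⟨fun p => (p.2.2.2.2.2, p.2.2.2.2.1, p.2.2.1, p.2.2.2.1, p.1, p.2.1),
          fun p => (p.2.2.2.2.1, p.2.2.2.2.2, p.2.2.1, p.2.2.2.1, p.2.1, p.1),
          fun _ => rfl, fun _ => rfl⟩ :
          X₁ × X₂ × Y₁ × Y₂ × κ₂ × κ₁ ≃ κ₁ × κ₂ × Y₁ × Y₂ × X₁ × X₂)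
        (fun p => f p.1 p.2.1 p.2.2.1 p.2.2.2.1 p.2.2.2.2.1 p.2.2.2.2.2)
        (fun p => f p.2.2.2.2.1 p.2.2.2.2.2 p.2.2.1 p.2.2.2.1 p.2.1 p.1) fun _ => rfl
      simpa only [Fintype.sum_prod_type] using h
    rw [e1]
    refine sum_congr rfl fun k₁ _ => sum_congr rfl fun k₂ _ => sum_congr rfl fun y₁ _ =>
      sum_congr rfl fun y₂ _ => sum_congr rfl fun x₁ _ => sum_congr rfl fun x₂ _ => by ring
  simp only [hker, weighted, mul_sum (univ : Finset S)]
  rw [sum_comm]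
  refine sum_le_sum fun k₁ _ => ?_
  rw [sum_comm]
  refine sum_le_sum fun k₂ _ => sum_le_sum fun s _ => ?_
  have hU := binSelect_le (a := fun l => M.densityU s (cu (w₁, l)))
    (fun _ => M.densityU_nonneg _ _) k₁
  have hV := binSelect_le (a := fun l => M.densityV s (cv (w₂, l)))
    (fun _ => M.densityV_nonneg _ _) k₂
  have hy : ∑ y₁, ∑ y₂, M.kernel s (cu (w₁, k₁)) (cv (w₂, k₂)) y₁ y₂ *
      ind ((d₁ y₁, d₂ y₂) ≠ (w₁, w₂)) ≤
      ∑ y₁, ∑ y₂, M.kernel s (cu (w₁, k₁)) (cv (w₂, k₂)) y₁ y₂ *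
        failures A C cu cv (w₁, k₁) (w₂, k₂) (cu (w₁, k₁)) (cv (w₂, k₂)) y₁ y₂ :=
    sum_le_sum fun y₁ _ => sum_le_sum fun y₂ _ =>
      mul_le_mul_of_nonneg_left (hd (w₁, k₁) (w₂, k₂) y₁ y₂) (M.kernel_nonneg _ _ _ _ _)
  have hy0 : 0 ≤ ∑ y₁, ∑ y₂, M.kernel s (cu (w₁, k₁)) (cv (w₂, k₂)) y₁ y₂ *
      ind ((d₁ y₁, d₂ y₂) ≠ (w₁, w₂)) :=
    sum_nonneg fun _ _ => sum_nonneg fun _ _ => mul_nonneg (M.kernel_nonneg _ _ _ _ _)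
      (ind_nonneg _)
  calc _ ≤ (M.densityU s (cu (w₁, k₁)) / Fintype.card κ₁ *
        (M.densityV s (cv (w₂, k₂)) / Fintype.card κ₂)) * _ :=
        mul_le_mul (mul_le_mul hU hV (bV0 _ _ _) ((bU0 w₁ s k₁).trans hU)) hy hy0
          (mul_nonneg ((bU0 w₁ s k₁).trans hU) ((bV0 w₂ s k₂).trans hV))
    _ = _ := by
        rw [div_mul_div_comm, div_eq_mul_one_div]
        ring

variable [DecidableEq κ₁]

theorem iidExp_failures_le [Nonempty W₁] [Nonempty W₂] (j : W₁ × κ₁) (m : W₂ × κ₂) :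
    iidExp M.lawU (fun cu : W₁ × κ₁ → U => iidExp M.lawV (fun cv : W₂ × κ₂ → V =>
      M.weighted (failures A C cu cv j m) (cu j) (cv m))) ≤
      M.failureBound A C (Fintype.card W₁) (Fintype.card W₂) (Fintype.card κ₁)
        (Fintype.card κ₂) := by
  have hc1 : ((#(univ.erase j.1) : ℕ) : ℝ) = (Fintype.card W₁ : ℝ) - 1 := by
    rw [card_erase_of_mem (mem_univ _), card_univ, Nat.cast_pred Fintype.card_pos]
  have hc2 : ((#(univ.erase m.1) : ℕ) : ℝ) = (Fintype.card W₂ : ℝ) - 1 := by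
    rw [card_erase_of_mem (mem_univ _), card_univ, Nat.cast_pred Fintype.card_pos]
  -- For the first decoder the other codewords in the bin of the true second message also count as
  -- false, so the whole second codebook enters.
  have hc3 : ((#(univ.erase m) : ℕ) : ℝ) ≤ (Fintype.card W₂ : ℝ) * Fintype.card κ₂ := by
    rw [← Nat.cast_mul, ← Fintype.card_prod]
    exact_mod_cast card_le_univ _
  unfold failures failureBound
  simp only [weighted_add, weighted_sum, iidExp_add, iidExp_sum]
  refine add_le_add (add_le_add (add_le_add ?_ ?_) (add_le_add ?_ ?_)) ?_
  · exact M.iidExp_weighted_le (fun _ _ _ _ => ind_nonneg _) j m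
  · exact M.iidExp_weighted_le (fun _ _ _ _ => ind_nonneg _) j m
  · refine (sum_le_sum fun w hw => sum_le_sum fun k _ => M.iidExp_weighted_left_le
      (f := fun u' _ v y₁ _ => ind (A u' v y₁)) (fun _ _ _ _ _ => ind_nonneg _)
      (j := j) (j' := (w, k)) (fun h => (mem_erase.1 hw).1 (congrArg Prod.fst h)) m).trans ?_
    rw [sum_const, sum_const, card_univ, nsmul_eq_mul, nsmul_eq_mul, hc1, mul_assoc]
  · refine (sum_le_sum fun w hw => sum_le_sum fun k _ => sum_le_sum fun m' hm' =>
      M.iidExp_weighted_both_le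
      (f := fun u' v' _ _ y₁ _ => ind (A u' v' y₁)) (fun _ _ _ _ _ _ => ind_nonneg _)
      (j := j) (j' := (w, k)) (fun h => (mem_erase.1 hw).1 (congrArg Prod.fst h))
      (mem_erase.1 hm').1).trans ?_
    rw [sum_const, sum_const, sum_const, card_univ, nsmul_eq_mul, nsmul_eq_mul, nsmul_eq_mul,
      hc1, mul_assoc, mul_assoc]
    have h0 : (0 : ℝ) ≤ (Fintype.card W₁ : ℝ) - 1 := by rw [← hc1]; positivity
    have h1 : 0 ≤ ∑ u', M.lawU u' * ∑ v', M.lawV v' *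
        M.ex (fun _ _ y₁ _ => ind (A u' v' y₁)) :=
      sum_nonneg fun _ _ => mul_nonneg (M.lawU_nonneg _) (sum_nonneg fun _ _ =>
        mul_nonneg (M.lawV_nonneg _) (M.ex_nonneg fun _ _ _ _ => ind_nonneg _))
    gcongr
  · refine (sum_le_sum fun w hw => sum_le_sum fun k _ => M.iidExp_weighted_right_le
      (f := fun v' _ _ _ y₂ => ind (C v' y₂)) (fun _ _ _ _ _ => ind_nonneg _)
      j (m := m) (m' := (w, k)) (fun h => (mem_erase.1 hw).1 (congrArg Prod.fst h))).trans ?_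
    rw [sum_const, sum_const, card_univ, nsmul_eq_mul, nsmul_eq_mul, hc2, mul_assoc]

/-- Some first codebook does no worse than the mean, and for it some second codebook does no worse
than the remaining mean. -/
theorem exists_code [Nonempty W₁] [Nonempty W₂] [Nonempty κ₁] [Nonempty κ₂]
    {τU θU τV θV : ℝ} (hθU : 0 < θU) (hτU : τU ≤ Fintype.card κ₁ * θU ^ 2)
    (hθV : 0 < θV) (hτV : τV ≤ Fintype.card κ₂ * θV ^ 2) :
    ∃ (e₁ : W₁ → S → X₁) (e₂ : W₂ → S → X₂) (d₁ : Y₁ → W₁) (d₂ : Y₂ → W₂),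
      M.errorProb e₁ e₂ d₁ d₂ ≤
        M.failureBound A C (Fintype.card W₁) (Fintype.card W₂) (Fintype.card κ₁)
          (Fintype.card κ₂) +
        (∑ s, ∑ u, M.state s * M.condU s u * ind (τU < M.densityU s u) + θU) +
        (∑ s, ∑ v, M.state s * M.condV s v * ind (τV < M.densityV s v) + θV) := by
  set Φ : (W₁ × κ₁ → U) → (W₂ × κ₂ → V) → ℝ := fun cu cv =>
    1 / ((Fintype.card W₁ : ℝ) * Fintype.card W₂) *
        ∑ w₁, ∑ w₂, (∑ k₁, ∑ k₂, 1 / ((Fintype.card κ₁ : ℝ) * Fintype.card κ₂) *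
          M.weighted (failures A C cu cv (w₁, k₁) (w₂, k₂)) (cu (w₁, k₁)) (cv (w₂, k₂)) +
          M.deficit M.condU cu w₁ + M.deficit M.condV cv w₂) with hΦ
  obtain ⟨cu, hcu⟩ := exists_le_iidExp M.lawU_nonneg M.sum_lawU
    (fun cu : W₁ × κ₁ → U => iidExp M.lawV (Φ cu))
  obtain ⟨cv, hcv⟩ := exists_le_iidExp M.lawV_nonneg M.sum_lawV (Φ cu)
  obtain ⟨e₁, e₂, d₁, d₂, h⟩ := M.exists_code_of_codebooks A C cu cv
  refine ⟨e₁, e₂, d₁, d₂, h.trans ((hcv.trans hcu).trans ?_)⟩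
  have c1 : (0 : ℝ) < Fintype.card W₁ := by exact_mod_cast Fintype.card_pos
  have c2 : (0 : ℝ) < Fintype.card W₂ := by exact_mod_cast Fintype.card_pos
  have c3 : (0 : ℝ) < Fintype.card κ₁ := by exact_mod_cast Fintype.card_pos
  have c4 : (0 : ℝ) < Fintype.card κ₂ := by exact_mod_cast Fintype.card_pos
  simp only [hΦ, iidExp_mul_left, iidExp_sum, iidExp_add, iidExp_const M.sum_lawU,
    iidExp_const M.sum_lawV]
  set B := M.failureBound A C (Fintype.card W₁) (Fintype.card W₂) (Fintype.card κ₁)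
          (Fintype.card κ₂) with hB
  calc _ ≤ 1 / ((Fintype.card W₁ : ℝ) * Fintype.card W₂) * ∑ _w₁ : W₁, ∑ _w₂ : W₂,
        (∑ _k₁ : κ₁, ∑ _k₂ : κ₂, 1 / ((Fintype.card κ₁ : ℝ) * Fintype.card κ₂) * B +
        (∑ s, ∑ u, M.state s * M.condU s u * ind (τU < M.densityU s u) + θU) +
        (∑ s, ∑ v, M.state s * M.condV s v * ind (τV < M.densityV s v) + θV)) := by
        refine mul_le_mul_of_nonneg_left (sum_le_sum fun w₁ _ => sum_le_sum fun w₂ _ =>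
          add_le_add (add_le_add (sum_le_sum fun k₁ _ => sum_le_sum fun k₂ _ => ?_) ?_) ?_)
          (by positivity)
        · exact mul_le_mul_of_nonneg_left (M.iidExp_failures_le A C _ _) (by positivity)
        · exact M.iidExp_deficit_le M.condU_nonneg M.sum_condU hθU hτU w₁
        · exact M.iidExp_deficit_le M.condV_nonneg M.sum_condV hθV hτV w₂
    _ = _ := by
        simp only [sum_const, card_univ, nsmul_eq_mul]
        field_simp

end RandomCoding

end BinningModel

/-! ### Independent uses of the channel -/

section Auxiliary

variable {ι α β : Type*} [Fintype ι] [DecidableEq ι] [Fintype α] [Fintype β]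

theorem sum_sum_prod_apply (f : ι → α → β → ℝ) :
    ∑ a : ι → α, ∑ b : ι → β, ∏ j, f j (a j) (b j) = ∏ j, ∑ a, ∑ b, f j a b := by
  rw [← sum_prod_apply]
  exact sum_congr rfl fun a _ => sum_prod_apply fun j b => f j (a j) b

theorem iidExp_prod (p : α → ℝ) (t : ι → α → ℝ) :
    iidExp p (fun c : ι → α => ∏ j, t j (c j)) = ∏ j, ∑ a, p a * t j a := by
  rw [← sum_prod_apply]
  exact sum_congr rfl fun c _ => prod_mul_distrib.symm

theorem iidExp_prod_fst_snd (p : α × β → ℝ) (F : (ι → α) → (ι → β) → ℝ) :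
    ∑ a, ∑ b, (∏ j, p (a j, b j)) * F a b =
      iidExp p (fun c : ι → α × β => F (fun j => (c j).1) (fun j => (c j).2)) := by
  rw [← Fintype.sum_prod_type']
  exact Fintype.sum_equiv (⟨fun c j => (c.1 j, c.2 j),
    fun c => (fun j => (c j).1, fun j => (c j).2),
    fun _ => rfl, fun _ => rfl⟩ : (ι → α) × (ι → β) ≃ (ι → α × β)) _ _ fun _ => rfl

theorem two_rpow_mul_tendsto_zero {x : ℝ} (hx : x < 0) :
    Tendsto (fun n : ℕ => (2 : ℝ) ^ ((n : ℝ) * x)) atTop (𝓝 0) := by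
  have h : ∀ n : ℕ, (2 : ℝ) ^ ((n : ℝ) * x) = ((2 : ℝ) ^ x) ^ n := fun n => by
    rw [mul_comm, Real.rpow_mul_natCast zero_le_two]
  simp only [h]
  exact tendsto_pow_atTop_nhds_zero_of_lt_one (by positivity)
    (Real.rpow_lt_one_of_one_lt_of_neg one_lt_two hx)

/-- The number of messages of a code of length `n` and rate `R`. -/
noncomputable abbrev messageCount (n : ℕ) (R : ℝ) : ℕ := ⌈(2 : ℝ) ^ ((n : ℝ) * R)⌉₊

theorem messageCount_pos (n : ℕ) (R : ℝ) : 0 < messageCount n R := Nat.ceil_pos.2 (by positivity)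

/-- Only false messages are counted here, so leaving out the true one absorbs the rounding and no
constant appears. -/
theorem messageCount_sub_one_le (n : ℕ) (R : ℝ) :
    (messageCount n R : ℝ) - 1 ≤ (2 : ℝ) ^ ((n : ℝ) * R) := by
  have := Nat.ceil_lt_add_one (show (0 : ℝ) ≤ (2 : ℝ) ^ ((n : ℝ) * R) by positivity)
  linarith

theorem messageCount_le (n : ℕ) {R : ℝ} (hR : 0 ≤ R) :
    (messageCount n R : ℝ) ≤ 2 * (2 : ℝ) ^ ((n : ℝ) * R) := by
  have h1 := messageCount_sub_one_le n R
  have h2 : (1 : ℝ) ≤ (2 : ℝ) ^ ((n : ℝ) * R) :=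
    Real.one_le_rpow one_le_two (by positivity)
  linarith

theorem messageCount_zero (n : ℕ) : messageCount n 0 = 1 := by simp [messageCount]

theorem ite_eq_ind_not (P : Prop) [Decidable P] : (if P then (0 : ℝ) else 1) = ind (¬P) := by
  by_cases h : P <;> simp [ind, h]

theorem ind_not_and_le (P Q : Prop) : ind (¬(P ∧ Q)) ≤ ind (¬P) + ind (¬Q) := by
  by_cases hP : P <;> by_cases hQ : Q <;> simp [ind, hP, hQ]

theorem ind_lt_le {x t : ℝ} (hx : 0 < x) (ht : 0 ≤ t) : ind (x < t) ≤ x⁻¹ * t := by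
  by_cases h : x < t
  · rw [ind_of h, inv_mul_eq_div, one_le_div hx]
    exact h.le
  · rw [ind_of_not h]; positivity

end Auxiliary

section MutualInformationNonneg

variable {S U : Type*} [Fintype S] [Fintype U] {μ : S → ℝ} {q : S → U → ℝ}

/-- This follows from log t ≥ 1 - 1/t. It makes the bin rates nonnegative, as `messageCount_le`
requires. -/
theorem sum_logb_density_nonneg (hμ : ∀ s, 0 ≤ μ s) (hμ1 : ∑ s, μ s = 1)
    (hq : ∀ s u, 0 ≤ q s u) (hq1 : ∀ s, ∑ u, q s u = 1) :
    0 ≤ ∑ s, ∑ u, μ s * q s u * Real.logb 2 (density μ q s u) := by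
  have hlog2 : 0 < Real.log 2 := Real.log_pos one_lt_two
  have h : ∀ s u, (μ s * q s u - μ s * marginal μ q u) / Real.log 2 ≤
      μ s * q s u * Real.logb 2 (density μ q s u) := by
    intro s u
    have hm := marginal_nonneg hμ hq u
    rw [Real.logb, ← mul_div_assoc]
    refine div_le_div_of_nonneg_right ?_ hlog2.le
    rcases (mul_nonneg (hμ s) (hq s u)).eq_or_lt' with h0 | h0
    · rw [h0]
      have := mul_nonneg (hμ s) hm
      linarith
    · have hqpos : 0 < q s u := (hq s u).lt_of_ne' fun h => by simp [h] at h0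
      have hmpos : 0 < marginal μ q u := h0.trans_le
        (single_le_sum (f := fun s => μ s * q s u) (fun s _ => mul_nonneg (hμ s) (hq s u))
          (mem_univ s))
      have h1 := Real.one_sub_inv_le_log_of_pos (div_pos hqpos hmpos)
      refine le_trans (le_of_eq ?_) (mul_le_mul_of_nonneg_left h1 h0.le)
      rw [inv_div]
      field_simp
  refine le_trans (le_of_eq ?_) (sum_le_sum fun s _ => sum_le_sum fun u _ => h s u)
  simp only [← sum_div, sum_sub_distrib, ← mul_sum, hq1, sum_marginal hμ1 hq1, sub_self, zero_div,
    sum_const_zero]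

end MutualInformationNonneg

/-! ### The n-fold model and its false-alarm probabilities -/

namespace BinningModel

variable {S U V X₁ X₂ Y₁ Y₂ : Type*} [Fintype S] [Fintype U] [Fintype V]
    [Fintype X₁] [Fintype X₂] [Fintype Y₁] [Fintype Y₂] (M : BinningModel S U V X₁ X₂ Y₁ Y₂)

/-- The model of `n` independent uses of the channel. -/
noncomputable def pow (n : ℕ) : BinningModel (Fin n → S) (Fin n → U) (Fin n → V) (Fin n → X₁)
    (Fin n → X₂) (Fin n → Y₁) (Fin n → Y₂) where
  state s := ∏ i, M.state (s i)
  condU s u := ∏ i, M.condU (s i) (u i)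
  condV s v := ∏ i, M.condV (s i) (v i)
  input₁ s u x := ∏ i, M.input₁ (s i) (u i) (x i)
  input₂ s v x := ∏ i, M.input₂ (s i) (v i) (x i)
  out s x₁ x₂ y₁ y₂ := ∏ i, M.out (s i) (x₁ i) (x₂ i) (y₁ i) (y₂ i)
  condU_nonneg _ _ := prod_nonneg fun _ _ => M.condU_nonneg _ _
  condV_nonneg _ _ := prod_nonneg fun _ _ => M.condV_nonneg _ _
  input₁_nonneg _ _ _ := prod_nonneg fun _ _ => M.input₁_nonneg _ _ _
  input₂_nonneg _ _ _ := prod_nonneg fun _ _ => M.input₂_nonneg _ _ _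
  out_nonneg _ _ _ _ _ := prod_nonneg fun _ _ => M.out_nonneg _ _ _ _ _
  sum_state := by
    rw [sum_prod_apply (fun _ => M.state)]; simp [M.sum_state]
  sum_condU s := by
    rw [sum_prod_apply (fun i => M.condU (s i))]; simp [M.sum_condU]
  sum_condV s := by
    rw [sum_prod_apply (fun i => M.condV (s i))]; simp [M.sum_condV]
  sum_input₁ s u := by
    rw [sum_prod_apply (fun i => M.input₁ (s i) (u i))]; simp [M.sum_input₁]
  sum_input₂ s v := by
    rw [sum_prod_apply (fun i => M.input₂ (s i) (v i))]; simp [M.sum_input₂]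
  sum_out s x₁ x₂ := by
    rw [sum_sum_prod_apply (fun i => M.out (s i) (x₁ i) (x₂ i))]; simp [M.sum_out]

variable (n : ℕ)

theorem marginal_pow {α β : Type*} [Fintype α] {μ : α → ℝ} {q : α → β → ℝ} (u : Fin n → β) :
    marginal (fun s : Fin n → α => ∏ i, μ (s i)) (fun s u => ∏ i, q (s i) (u i)) u =
      ∏ i, marginal μ q (u i) := by
  unfold marginal
  rw [← sum_prod_apply]
  exact sum_congr rfl fun s _ => prod_mul_distrib.symm

theorem density_pow {α β : Type*} [Fintype α] {μ : α → ℝ} {q : α → β → ℝ} (s : Fin n → α)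
    (u : Fin n → β) :
    density (fun s : Fin n → α => ∏ i, μ (s i)) (fun s u => ∏ i, q (s i) (u i)) s u =
      ∏ i, density μ q (s i) (u i) := by
  unfold density
  rw [marginal_pow, prod_div_distrib]

theorem lawU_pow (u : Fin n → U) : (M.pow n).lawU u = ∏ i, M.lawU (u i) := marginal_pow n u
theorem lawV_pow (v : Fin n → V) : (M.pow n).lawV v = ∏ i, M.lawV (v i) := marginal_pow n v

theorem kernel_pow (s : Fin n → S) (u : Fin n → U) (v : Fin n → V) (y₁ : Fin n → Y₁)
    (y₂ : Fin n → Y₂) :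
    (M.pow n).kernel s u v y₁ y₂ = ∏ i, M.kernel (s i) (u i) (v i) (y₁ i) (y₂ i) := by
  unfold kernel
  rw [← sum_sum_prod_apply (fun i x₁ x₂ => M.input₁ (s i) (u i) x₁ * M.input₂ (s i) (v i) x₂ *
    M.out (s i) x₁ x₂ (y₁ i) (y₂ i))]
  simp only [prod_mul_distrib]
  rfl

theorem joint_pow (ω : (Fin n → S) × (Fin n → U) × (Fin n → V) × (Fin n → Y₁) × (Fin n → Y₂)) :
    (M.pow n).joint ω =
      ∏ i, M.joint (ω.1 i, ω.2.1 i, ω.2.2.1 i, ω.2.2.2.1 i, ω.2.2.2.2 i) := by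
  unfold joint
  rw [kernel_pow]
  simp only [prod_mul_distrib]
  rfl

theorem ex_pow (f : (Fin n → U) → (Fin n → V) → (Fin n → Y₁) → (Fin n → Y₂) → ℝ) :
    (M.pow n).ex f = iidExp M.joint (fun c : Fin n → S × U × V × Y₁ × Y₂ =>
      f (fun i => (c i).2.1) (fun i => (c i).2.2.1) (fun i => (c i).2.2.2.1)
        (fun i => (c i).2.2.2.2)) := by
  unfold ex iidExp
  simp only [joint_pow]
  exact Fintype.sum_equiv
    (⟨fun ω i => (ω.1 i, ω.2.1 i, ω.2.2.1 i, ω.2.2.2.1 i, ω.2.2.2.2 i),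
      fun c => (fun i => (c i).1, fun i => (c i).2.1, fun i => (c i).2.2.1,
        fun i => (c i).2.2.2.1, fun i => (c i).2.2.2.2), fun _ => rfl, fun _ => rfl⟩ :
      (Fin n → S) × (Fin n → U) × (Fin n → V) × (Fin n → Y₁) × (Fin n → Y₂) ≃
        (Fin n → S × U × V × Y₁ × Y₂)) _ _ fun _ => rfl

theorem ex_mono {f g : U → V → Y₁ → Y₂ → ℝ} (h : ∀ u v y₁ y₂, f u v y₁ y₂ ≤ g u v y₁ y₂) :
    M.ex f ≤ M.ex g :=
  sum_le_sum fun _ _ => mul_le_mul_of_nonneg_left (h _ _ _ _) (M.joint_nonneg _)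

theorem ex_mul_left (a : ℝ) (f : U → V → Y₁ → Y₂ → ℝ) :
    M.ex (fun u v y₁ y₂ => a * f u v y₁ y₂) = a * M.ex f := by
  unfold ex
  rw [mul_sum]
  exact sum_congr rfl fun _ _ => by ring

theorem ex_pow_prod (t : Fin n → U → V → Y₁ → Y₂ → ℝ) :
    (M.pow n).ex (fun u v y₁ y₂ => ∏ i, t i (u i) (v i) (y₁ i) (y₂ i)) = ∏ i, M.ex (t i) := by
  rw [ex_pow]
  exact iidExp_prod M.joint (fun i ω => t i ω.2.1 ω.2.2.1 ω.2.2.2.1 ω.2.2.2.2)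

/-- Markov's inequality: the mean of the product is the n-th power of the mean for one use, which is
at most one. The next two bounds hold for the same reason. -/
theorem false_alarm_left_le {t : U → V → Y₁ → ℝ} (ht : ∀ u v y, 0 ≤ t u v y)
    (h : ∑ u', M.lawU u' * M.ex (fun _ v y₁ _ => t u' v y₁) ≤ 1) {x : ℝ} (hx : 0 < x) :
    ∑ u', (M.pow n).lawU u' * (M.pow n).ex (fun _ v y₁ _ =>
      ind (x < ∏ i, t (u' i) (v i) (y₁ i))) ≤ x⁻¹ := by
  have h0 : 0 ≤ ∑ u', M.lawU u' * M.ex (fun _ v y₁ _ => t u' v y₁) :=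
    sum_nonneg fun _ _ => mul_nonneg (M.lawU_nonneg _) (M.ex_nonneg fun _ _ _ _ => ht _ _ _)
  calc _ ≤ ∑ u', (M.pow n).lawU u' * (M.pow n).ex (fun _ v y₁ _ =>
        x⁻¹ * ∏ i, t (u' i) (v i) (y₁ i)) :=
        sum_le_sum fun _ _ => mul_le_mul_of_nonneg_left ((M.pow n).ex_mono fun _ _ _ _ =>
          ind_lt_le hx (prod_nonneg fun _ _ => ht _ _ _)) ((M.pow n).lawU_nonneg _)
    _ = x⁻¹ * (∑ u', M.lawU u' * M.ex (fun _ v y₁ _ => t u' v y₁)) ^ n := by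
        have e : ∀ u' : Fin n → U, (M.pow n).ex (fun _ v y₁ _ => ∏ i, t (u' i) (v i) (y₁ i)) =
            ∏ i, M.ex (fun _ v y₁ _ => t (u' i) v y₁) := fun u' =>
          M.ex_pow_prod n (fun i _ v y₁ _ => t (u' i) v y₁)
        simp only [ex_mul_left, e, lawU_pow, mul_left_comm _ x⁻¹]
        rw [← mul_sum]
        congr 1
        exact (iidExp_prod M.lawU (fun _ u' => M.ex (fun _ v y₁ _ => t u' v y₁))).trans (by simp)
    _ ≤ x⁻¹ := mul_le_of_le_one_right (by positivity) (pow_le_one₀ h0 h)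

theorem false_alarm_right_le {t : V → Y₂ → ℝ} (ht : ∀ v y, 0 ≤ t v y)
    (h : ∑ v', M.lawV v' * M.ex (fun _ _ _ y₂ => t v' y₂) ≤ 1) {x : ℝ} (hx : 0 < x) :
    ∑ v', (M.pow n).lawV v' * (M.pow n).ex (fun _ _ _ y₂ =>
      ind (x < ∏ i, t (v' i) (y₂ i))) ≤ x⁻¹ := by
  have h0 : 0 ≤ ∑ v', M.lawV v' * M.ex (fun _ _ _ y₂ => t v' y₂) :=
    sum_nonneg fun _ _ => mul_nonneg (M.lawV_nonneg _) (M.ex_nonneg fun _ _ _ _ => ht _ _)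
  calc _ ≤ ∑ v', (M.pow n).lawV v' * (M.pow n).ex (fun _ _ _ y₂ =>
        x⁻¹ * ∏ i, t (v' i) (y₂ i)) :=
        sum_le_sum fun _ _ => mul_le_mul_of_nonneg_left ((M.pow n).ex_mono fun _ _ _ _ =>
          ind_lt_le hx (prod_nonneg fun _ _ => ht _ _)) ((M.pow n).lawV_nonneg _)
    _ = x⁻¹ * (∑ v', M.lawV v' * M.ex (fun _ _ _ y₂ => t v' y₂)) ^ n := by
        have e : ∀ v' : Fin n → V, (M.pow n).ex (fun _ _ _ y₂ => ∏ i, t (v' i) (y₂ i)) =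
            ∏ i, M.ex (fun _ _ _ y₂ => t (v' i) y₂) := fun v' =>
          M.ex_pow_prod n (fun i _ _ _ y₂ => t (v' i) y₂)
        simp only [ex_mul_left, e, lawV_pow, mul_left_comm _ x⁻¹]
        rw [← mul_sum]
        congr 1
        exact (iidExp_prod M.lawV (fun _ v' => M.ex (fun _ _ _ y₂ => t v' y₂))).trans (by simp)
    _ ≤ x⁻¹ := mul_le_of_le_one_right (by positivity) (pow_le_one₀ h0 h)

theorem false_alarm_both_le {t : U → V → Y₁ → ℝ} (ht : ∀ u v y, 0 ≤ t u v y)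
    (h : ∑ u', M.lawU u' * ∑ v', M.lawV v' * M.ex (fun _ _ y₁ _ => t u' v' y₁) ≤ 1)
    {x : ℝ} (hx : 0 < x) :
    ∑ u', (M.pow n).lawU u' * ∑ v', (M.pow n).lawV v' * (M.pow n).ex (fun _ _ y₁ _ =>
      ind (x < ∏ i, t (u' i) (v' i) (y₁ i))) ≤ x⁻¹ := by
  have h0 : 0 ≤ ∑ u', M.lawU u' * ∑ v', M.lawV v' * M.ex (fun _ _ y₁ _ => t u' v' y₁) :=
    sum_nonneg fun _ _ => mul_nonneg (M.lawU_nonneg _) (sum_nonneg fun _ _ =>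
      mul_nonneg (M.lawV_nonneg _) (M.ex_nonneg fun _ _ _ _ => ht _ _ _))
  calc _ ≤ ∑ u', (M.pow n).lawU u' * ∑ v', (M.pow n).lawV v' * (M.pow n).ex (fun _ _ y₁ _ =>
        x⁻¹ * ∏ i, t (u' i) (v' i) (y₁ i)) :=
        sum_le_sum fun _ _ => mul_le_mul_of_nonneg_left (sum_le_sum fun _ _ =>
          mul_le_mul_of_nonneg_left ((M.pow n).ex_mono fun _ _ _ _ =>
          ind_lt_le hx (prod_nonneg fun _ _ => ht _ _ _)) ((M.pow n).lawV_nonneg _))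
          ((M.pow n).lawU_nonneg _)
    _ = x⁻¹ * (∑ u', M.lawU u' * ∑ v', M.lawV v' * M.ex (fun _ _ y₁ _ => t u' v' y₁)) ^ n := by
        have e : ∀ (u' : Fin n → U) (v' : Fin n → V),
            (M.pow n).ex (fun _ _ y₁ _ => ∏ i, t (u' i) (v' i) (y₁ i)) =
            ∏ i, M.ex (fun _ _ y₁ _ => t (u' i) (v' i) y₁) := fun u' v' =>
          M.ex_pow_prod n (fun i _ _ y₁ _ => t (u' i) (v' i) y₁)
        have e2 : ∀ u' : Fin n → U, ∑ v' : Fin n → V, (∏ i, M.lawV (v' i)) *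
            ∏ i, M.ex (fun _ _ y₁ _ => t (u' i) (v' i) y₁) =
            ∏ i, ∑ v', M.lawV v' * M.ex (fun _ _ y₁ _ => t (u' i) v' y₁) := fun u' =>
          iidExp_prod M.lawV (fun i v' => M.ex (fun _ _ y₁ _ => t (u' i) v' y₁))
        simp only [ex_mul_left, e, lawU_pow, lawV_pow, mul_left_comm _ x⁻¹, ← mul_sum, e2]
        congr 1
        exact (iidExp_prod M.lawU (fun _ u' => ∑ v', M.lawV v' *
          M.ex (fun _ _ y₁ _ => t u' v' y₁))).trans (by simp)
    _ ≤ x⁻¹ := mul_le_of_le_one_right (by positivity) (pow_le_one₀ h0 h)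

end BinningModel

/-! ### Rates of codes for many uses of the channel -/

namespace BinningModel

variable {S U V X₁ X₂ Y₁ Y₂ : Type*} [Fintype S] [Fintype U] [Fintype V]
    [Fintype X₁] [Fintype X₂] [Fintype Y₁] [Fintype Y₂] (M : BinningModel S U V X₁ X₂ Y₁ Y₂)

theorem ex_not_lt_prod_tendsto_zero {t : U → V → Y₁ → Y₂ → ℝ}
    (ht : ∀ ω, M.joint ω ≠ 0 → 0 < t ω.2.1 ω.2.2.1 ω.2.2.2.1 ω.2.2.2.2) {x : ℝ}
    (hx : x < M.ex (fun u v y₁ y₂ => Real.logb 2 (t u v y₁ y₂))) :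
    Tendsto (fun n : ℕ => (M.pow n).ex (fun u v y₁ y₂ =>
      ind (¬(2 : ℝ) ^ ((n : ℝ) * x) < ∏ i, t (u i) (v i) (y₁ i) (y₂ i)))) atTop (𝓝 0) := by
  refine (iidExp_prod_le_tendsto_zero M.joint_nonneg M.sum_joint
    (t := fun ω => t ω.2.1 ω.2.2.1 ω.2.2.2.1 ω.2.2.2.2) ht hx).congr fun n => ?_
  rw [ex_pow]
  refine sum_congr rfl fun c _ => ?_
  congr 1
  exact ite_eq_ind_not _

/-- A bin rate above the mutual information makes the selection succeed with probability tending to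
one. -/
theorem exists_cover_parameters {α β : Type*} [Fintype α] [Fintype β] {μ : α → ℝ}
    {q : α → β → ℝ} (hμ : ∀ s, 0 ≤ μ s) (hμ1 : ∑ s, μ s = 1) (hq : ∀ s u, 0 ≤ q s u)
    (hq1 : ∀ s, ∑ u, q s u = 1) {r : ℝ}
    (hr : ∑ s, ∑ u, μ s * q s u * Real.logb 2 (density μ q s u) < r) :
    ∃ τ θ : ℕ → ℝ, (∀ n, 0 < θ n) ∧ (∀ n, τ n ≤ messageCount n r * θ n ^ 2) ∧
      Tendsto (fun n : ℕ => ∑ s : Fin n → α, ∑ u : Fin n → β, (∏ i, μ (s i)) *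
        (∏ i, q (s i) (u i)) * ind (τ n < ∏ i, density μ q (s i) (u i)) + θ n) atTop (𝓝 0) := by
  obtain ⟨τ₀, h1, h2⟩ := exists_between hr
  -- The square of θ is the ratio of the threshold to the unrounded bin size, the least that the
  -- constraint between them allows in general. It tends to zero because τ₀ < r, while τ₀ above the
  -- mean log-density makes truncation negligible.
  refine ⟨fun n => (2 : ℝ) ^ ((n : ℝ) * τ₀), fun n => (2 : ℝ) ^ ((n : ℝ) * ((τ₀ - r) / 2)),
    fun n => by positivity, fun n => ?_, ?_⟩
  · have h3 : (2 : ℝ) ^ ((n : ℝ) * τ₀) =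
        (2 : ℝ) ^ ((n : ℝ) * r) * ((2 : ℝ) ^ ((n : ℝ) * ((τ₀ - r) / 2))) ^ 2 := by
      rw [← Real.rpow_mul_natCast zero_le_two, ← Real.rpow_add two_pos]
      congr 1
      push_cast
      ring
    simp only [h3]
    exact mul_le_mul_of_nonneg_right (Nat.le_ceil _) (by positivity)
  · have hlim := iidExp_lt_prod_tendsto_zero (p := fun ω : α × β => μ ω.1 * q ω.1 ω.2)
      (t := fun ω => density μ q ω.1 ω.2) (x := τ₀) (fun ω => mul_nonneg (hμ _) (hq _ _))
      (by simp only [Fintype.sum_prod_type, ← mul_sum, hq1, mul_one, hμ1]) ?_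
      (by simpa only [Fintype.sum_prod_type] using h1)
    · have h0 := two_rpow_mul_tendsto_zero (x := (τ₀ - r) / 2) (by linarith)
      have h4 := hlim.add h0
      rw [add_zero] at h4
      refine h4.congr fun n => ?_
      congr 1
      rw [← iidExp_prod_fst_snd (fun ω : α × β => μ ω.1 * q ω.1 ω.2)
        (fun s u => if (2 : ℝ) ^ ((n : ℝ) * τ₀) < ∏ j, density μ q (s j) (u j) then (1 : ℝ) else 0)]
      refine sum_congr rfl fun s _ => sum_congr rfl fun u _ => ?_
      simp only [prod_mul_distrib, ind]
    · intro ω hω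
      have hpos : 0 < μ ω.1 * q ω.1 ω.2 := (mul_nonneg (hμ _) (hq _ _)).lt_of_ne' hω
      refine div_pos ((hq _ _).lt_of_ne' fun h => hω (by simp [h])) (hpos.trans_le ?_)
      exact single_le_sum (f := fun s => μ s * q s ω.2) (fun s _ => mul_nonneg (hμ s) (hq s _))
        (mem_univ ω.1)

/-- The part of the bound on the number of failures that is due to the first decoder. -/
noncomputable def leftBound (A : U → V → Y₁ → Prop) (N₁ N₂ L K : ℝ) : ℝ :=
  M.ex (fun u v y₁ _ => ind (¬A u v y₁)) +
    ((N₁ - 1) * L * ∑ u', M.lawU u' * M.ex (fun _ v y₁ _ => ind (A u' v y₁)) +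
      (N₁ - 1) * L * (N₂ * K) *
        ∑ u', M.lawU u' * ∑ v', M.lawV v' * M.ex (fun _ _ y₁ _ => ind (A u' v' y₁)))

/-- The part of the bound on the number of failures that is due to the second decoder. -/
noncomputable def rightBound (C : V → Y₂ → Prop) (N₂ K : ℝ) : ℝ :=
  M.ex (fun _ v _ y₂ => ind (¬C v y₂)) +
    (N₂ - 1) * K * ∑ v', M.lawV v' * M.ex (fun _ _ _ y₂ => ind (C v' y₂))

theorem failureBound_eq (A : U → V → Y₁ → Prop) (C : V → Y₂ → Prop) (N₁ N₂ L K : ℝ) :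
    M.failureBound A C N₁ N₂ L K = M.leftBound A N₁ N₂ L K + M.rightBound C N₂ K := by
  unfold failureBound leftBound rightBound
  ring

theorem leftBound_nonneg (A : U → V → Y₁ → Prop) {N₁ N₂ L K : ℝ} (h₁ : 1 ≤ N₁) (h₂ : 0 ≤ N₂)
    (hL : 0 ≤ L) (hK : 0 ≤ K) : 0 ≤ M.leftBound A N₁ N₂ L K := by
  have a1 : 0 ≤ M.ex (fun u v y₁ _ => ind (¬A u v y₁)) := M.ex_nonneg fun _ _ _ _ => ind_nonneg _
  have a2 : 0 ≤ ∑ u', M.lawU u' * M.ex (fun _ v y₁ _ => ind (A u' v y₁)) :=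
    sum_nonneg fun _ _ => mul_nonneg (M.lawU_nonneg _) (M.ex_nonneg fun _ _ _ _ => ind_nonneg _)
  have a3 : 0 ≤ ∑ u', M.lawU u' * ∑ v', M.lawV v' * M.ex (fun _ _ y₁ _ => ind (A u' v' y₁)) :=
    sum_nonneg fun _ _ => mul_nonneg (M.lawU_nonneg _) (sum_nonneg fun _ _ =>
      mul_nonneg (M.lawV_nonneg _) (M.ex_nonneg fun _ _ _ _ => ind_nonneg _))
  have a4 : 0 ≤ N₁ - 1 := by linarith
  unfold leftBound
  positivity

theorem rightBound_nonneg (C : V → Y₂ → Prop) {N₂ K : ℝ} (h₂ : 1 ≤ N₂) (hK : 0 ≤ K) :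
    0 ≤ M.rightBound C N₂ K := by
  have a1 : 0 ≤ M.ex (fun _ v _ y₂ => ind (¬C v y₂)) := M.ex_nonneg fun _ _ _ _ => ind_nonneg _
  have a2 : 0 ≤ ∑ v', M.lawV v' * M.ex (fun _ _ _ y₂ => ind (C v' y₂)) :=
    sum_nonneg fun _ _ => mul_nonneg (M.lawV_nonneg _) (M.ex_nonneg fun _ _ _ _ => ind_nonneg _)
  have a4 : 0 ≤ N₂ - 1 := by linarith
  unfold rightBound
  positivity

theorem one_le_messageCount (n : ℕ) (R : ℝ) : (1 : ℝ) ≤ messageCount n R := by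
  exact_mod_cast messageCount_pos n R

/-- Two thresholds are imposed at once: `tA` controls a false U beside the true V, and `tB` controls
a false U beside a false V. -/
theorem exists_left_tests {R₁ R₂ r k : ℝ} (hR₂ : 0 ≤ R₂) (hr : 0 ≤ r) (hk : 0 ≤ k)
    {tA tB : U → V → Y₁ → ℝ} (hA0 : ∀ u v y, 0 ≤ tA u v y) (hB0 : ∀ u v y, 0 ≤ tB u v y)
    (hA : ∀ ω, M.joint ω ≠ 0 → 0 < tA ω.2.1 ω.2.2.1 ω.2.2.2.1)
    (hB : ∀ ω, M.joint ω ≠ 0 → 0 < tB ω.2.1 ω.2.2.1 ω.2.2.2.1)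
    (hA1 : ∑ u', M.lawU u' * M.ex (fun _ v y₁ _ => tA u' v y₁) ≤ 1)
    (hB1 : ∑ u', M.lawU u' * ∑ v', M.lawV v' * M.ex (fun _ _ y₁ _ => tB u' v' y₁) ≤ 1)
    (h : R₁ = 0 ∨ (R₁ + r < M.ex (fun u v y₁ _ => Real.logb 2 (tA u v y₁)) ∧
      R₁ + r + R₂ + k < M.ex (fun u v y₁ _ => Real.logb 2 (tB u v y₁)))) :
    ∃ A : ∀ n, (Fin n → U) → (Fin n → V) → (Fin n → Y₁) → Prop,
      Tendsto (fun n : ℕ => (M.pow n).leftBound (A n) (messageCount n R₁) (messageCount n R₂)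
        (messageCount n r) (messageCount n k)) atTop (𝓝 0) := by
  rcases h with rfl | ⟨ha, hb⟩
  -- With a single message there is nothing to confuse, so the test may always pass. This covers a
  -- zero rate when no strict inequality is available.
  · refine ⟨fun _ _ _ _ => True, ?_⟩
    simp [leftBound, messageCount_zero, ind, ex]
  obtain ⟨a, ha1, ha2⟩ := exists_between ha
  obtain ⟨b, hb1, hb2⟩ := exists_between hb
  refine ⟨fun n u v y => (2 : ℝ) ^ ((n : ℝ) * a) < ∏ i, tA (u i) (v i) (y i) ∧
    (2 : ℝ) ^ ((n : ℝ) * b) < ∏ i, tB (u i) (v i) (y i), ?_⟩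
  have lim1 := M.ex_not_lt_prod_tendsto_zero (t := fun u v y₁ _ => tA u v y₁) hA ha2
  have lim2 := M.ex_not_lt_prod_tendsto_zero (t := fun u v y₁ _ => tB u v y₁) hB hb2
  -- The constant 2 comes from rounding the bin size; 8 comes from rounding the sizes at rates `r`,
  -- `R₂` and `k`.
  have lim3 := (two_rpow_mul_tendsto_zero (x := R₁ + r - a) (by linarith)).const_mul 2
  have lim4 := (two_rpow_mul_tendsto_zero (x := R₁ + r + R₂ + k - b) (by linarith)).const_mul 8
  have lim := (lim1.add lim2).add (lim3.add lim4)
  simp only [mul_zero, add_zero] at lim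
  refine squeeze_zero (fun n => leftBound_nonneg _ _ (one_le_messageCount _ _)
    (Nat.cast_nonneg _) (Nat.cast_nonneg _) (Nat.cast_nonneg _)) (fun n => ?_) lim
  have c1 := messageCount_sub_one_le n R₁
  have c1' : 0 ≤ (messageCount n R₁ : ℝ) - 1 := by linarith [one_le_messageCount n R₁]
  have c2 := messageCount_le n hr
  have c3 := messageCount_le n hR₂
  have c4 := messageCount_le n hk
  have fa := M.false_alarm_left_le n hA0 hA1 (x := (2 : ℝ) ^ ((n : ℝ) * a)) (by positivity)
  have fb := M.false_alarm_both_le n hB0 hB1 (x := (2 : ℝ) ^ ((n : ℝ) * b)) (by positivity)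
  refine add_le_add ?_ (add_le_add ?_ ?_)
  · rw [ex_pow, ex_pow, ex_pow, ← iidExp_add]
    exact iidExp_mono M.joint_nonneg fun c => ind_not_and_le _ _
  · have fa' : ∑ u', (M.pow n).lawU u' * (M.pow n).ex (fun _ v y₁ _ =>
        ind ((2 : ℝ) ^ ((n : ℝ) * a) < ∏ i, tA (u' i) (v i) (y₁ i) ∧
          (2 : ℝ) ^ ((n : ℝ) * b) < ∏ i, tB (u' i) (v i) (y₁ i))) ≤
        ((2 : ℝ) ^ ((n : ℝ) * a))⁻¹ := by
      refine le_trans (sum_le_sum fun u' _ => mul_le_mul_of_nonneg_left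
        ((M.pow n).ex_mono fun _ v y₁ _ => ?_) ((M.pow n).lawU_nonneg u')) fa
      by_cases hP : (2 : ℝ) ^ ((n : ℝ) * a) < ∏ i, tA (u' i) (v i) (y₁ i)
      · rw [ind_of hP]; exact ind_le_one _
      · rw [ind_of_not hP, ind_of_not fun h => hP h.1]
    calc _ ≤ ((2 : ℝ) ^ ((n : ℝ) * R₁) * (2 * (2 : ℝ) ^ ((n : ℝ) * r))) *
          ((2 : ℝ) ^ ((n : ℝ) * a))⁻¹ := by
          refine mul_le_mul (by gcongr) fa' (sum_nonneg fun _ _ => mul_nonneg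
            ((M.pow n).lawU_nonneg _) ((M.pow n).ex_nonneg fun _ _ _ _ => ind_nonneg _))
            (by positivity)
      _ = 2 * ((2 : ℝ) ^ ((n : ℝ) * R₁) * (2 : ℝ) ^ ((n : ℝ) * r) *
          ((2 : ℝ) ^ ((n : ℝ) * a))⁻¹) := by ring
      _ = _ := by
          rw [← Real.rpow_neg zero_le_two, ← Real.rpow_add two_pos, ← Real.rpow_add two_pos]
          congr 2
          ring
  · have fb' : ∑ u', (M.pow n).lawU u' * ∑ v', (M.pow n).lawV v' * (M.pow n).ex (fun _ _ y₁ _ =>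
        ind ((2 : ℝ) ^ ((n : ℝ) * a) < ∏ i, tA (u' i) (v' i) (y₁ i) ∧
          (2 : ℝ) ^ ((n : ℝ) * b) < ∏ i, tB (u' i) (v' i) (y₁ i))) ≤
        ((2 : ℝ) ^ ((n : ℝ) * b))⁻¹ := by
      refine le_trans (sum_le_sum fun u' _ => mul_le_mul_of_nonneg_left
        (sum_le_sum fun v' _ => mul_le_mul_of_nonneg_left
        ((M.pow n).ex_mono fun _ _ y₁ _ => ?_) ((M.pow n).lawV_nonneg v'))
        ((M.pow n).lawU_nonneg u')) fb
      by_cases hQ : (2 : ℝ) ^ ((n : ℝ) * b) < ∏ i, tB (u' i) (v' i) (y₁ i)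
      · rw [ind_of hQ]; exact ind_le_one _
      · rw [ind_of_not hQ, ind_of_not fun h => hQ h.2]
    calc _ ≤ ((2 : ℝ) ^ ((n : ℝ) * R₁) * (2 * (2 : ℝ) ^ ((n : ℝ) * r)) *
          ((2 * (2 : ℝ) ^ ((n : ℝ) * R₂)) * (2 * (2 : ℝ) ^ ((n : ℝ) * k)))) *
          ((2 : ℝ) ^ ((n : ℝ) * b))⁻¹ := by
          refine mul_le_mul (by gcongr) fb' (sum_nonneg fun _ _ => mul_nonneg
            ((M.pow n).lawU_nonneg _) (sum_nonneg fun _ _ => mul_nonneg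
            ((M.pow n).lawV_nonneg _) ((M.pow n).ex_nonneg fun _ _ _ _ => ind_nonneg _)))
            (by positivity)
      _ = 8 * ((2 : ℝ) ^ ((n : ℝ) * R₁) * (2 : ℝ) ^ ((n : ℝ) * r) * (2 : ℝ) ^ ((n : ℝ) * R₂) *
          (2 : ℝ) ^ ((n : ℝ) * k) * ((2 : ℝ) ^ ((n : ℝ) * b))⁻¹) := by ring
      _ = _ := by
          rw [← Real.rpow_neg zero_le_two, ← Real.rpow_add two_pos, ← Real.rpow_add two_pos,
            ← Real.rpow_add two_pos, ← Real.rpow_add two_pos]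
          congr 2
          ring

theorem exists_right_tests {R₂ k : ℝ} (hk : 0 ≤ k)
    {t : V → Y₂ → ℝ} (ht0 : ∀ v y, 0 ≤ t v y)
    (ht : ∀ ω, M.joint ω ≠ 0 → 0 < t ω.2.2.1 ω.2.2.2.2)
    (ht1 : ∑ v', M.lawV v' * M.ex (fun _ _ _ y₂ => t v' y₂) ≤ 1)
    (h : R₂ = 0 ∨ R₂ + k < M.ex (fun _ v _ y₂ => Real.logb 2 (t v y₂))) :
    ∃ C : ∀ n, (Fin n → V) → (Fin n → Y₂) → Prop,
      Tendsto (fun n : ℕ => (M.pow n).rightBound (C n) (messageCount n R₂) (messageCount n k))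
        atTop (𝓝 0) := by
  rcases h with rfl | h
  · refine ⟨fun _ _ _ => True, ?_⟩
    simp [rightBound, messageCount_zero, ind, ex]
  obtain ⟨a, ha1, ha2⟩ := exists_between h
  refine ⟨fun n v y => (2 : ℝ) ^ ((n : ℝ) * a) < ∏ i, t (v i) (y i), ?_⟩
  have lim1 := M.ex_not_lt_prod_tendsto_zero (t := fun _ v _ y₂ => t v y₂) ht ha2
  have lim2 := (two_rpow_mul_tendsto_zero (x := R₂ + k - a) (by linarith)).const_mul 2
  have lim := lim1.add lim2
  simp only [mul_zero, add_zero] at lim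
  refine squeeze_zero (fun n => rightBound_nonneg _ _ (one_le_messageCount _ _)
    (Nat.cast_nonneg _)) (fun n => add_le_add le_rfl ?_) lim
  have c1 := messageCount_sub_one_le n R₂
  have c2 := messageCount_le n hk
  have fa := M.false_alarm_right_le n ht0 ht1 (x := (2 : ℝ) ^ ((n : ℝ) * a)) (by positivity)
  calc _ ≤ ((2 : ℝ) ^ ((n : ℝ) * R₂) * (2 * (2 : ℝ) ^ ((n : ℝ) * k))) *
        ((2 : ℝ) ^ ((n : ℝ) * a))⁻¹ := by
        refine mul_le_mul (by gcongr) fa (sum_nonneg fun _ _ => mul_nonneg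
          ((M.pow n).lawV_nonneg _) ((M.pow n).ex_nonneg fun _ _ _ _ => ind_nonneg _))
          (by positivity)
    _ = 2 * ((2 : ℝ) ^ ((n : ℝ) * R₂) * (2 : ℝ) ^ ((n : ℝ) * k) *
        ((2 : ℝ) ^ ((n : ℝ) * a))⁻¹) := by ring
    _ = _ := by
        rw [← Real.rpow_neg zero_le_two, ← Real.rpow_add two_pos, ← Real.rpow_add two_pos]
        congr 2
        ring

/-- The bin rates are squeezed from both sides: selection needs `r` and `k` large, decoding needs
them small. -/
theorem exists_codes {R₁ R₂ r k : ℝ} (hR₂ : 0 ≤ R₂)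
    {tA tB : U → V → Y₁ → ℝ} {tC : V → Y₂ → ℝ}
    (hA0 : ∀ u v y, 0 ≤ tA u v y) (hB0 : ∀ u v y, 0 ≤ tB u v y) (hC0 : ∀ v y, 0 ≤ tC v y)
    (hA : ∀ ω, M.joint ω ≠ 0 → 0 < tA ω.2.1 ω.2.2.1 ω.2.2.2.1)
    (hB : ∀ ω, M.joint ω ≠ 0 → 0 < tB ω.2.1 ω.2.2.1 ω.2.2.2.1)
    (hC : ∀ ω, M.joint ω ≠ 0 → 0 < tC ω.2.2.1 ω.2.2.2.2)
    (hA1 : ∑ u', M.lawU u' * M.ex (fun _ v y₁ _ => tA u' v y₁) ≤ 1)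
    (hB1 : ∑ u', M.lawU u' * ∑ v', M.lawV v' * M.ex (fun _ _ y₁ _ => tB u' v' y₁) ≤ 1)
    (hC1 : ∑ v', M.lawV v' * M.ex (fun _ _ _ y₂ => tC v' y₂) ≤ 1)
    (hr : ∑ s, ∑ u, M.state s * M.condU s u * Real.logb 2 (M.densityU s u) < r)
    (hk : ∑ s, ∑ v, M.state s * M.condV s v * Real.logb 2 (M.densityV s v) < k)
    (h₁ : R₁ = 0 ∨ (R₁ + r < M.ex (fun u v y₁ _ => Real.logb 2 (tA u v y₁)) ∧
      R₁ + r + R₂ + k < M.ex (fun u v y₁ _ => Real.logb 2 (tB u v y₁))))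
    (h₂ : R₂ = 0 ∨ R₂ + k < M.ex (fun _ v _ y₂ => Real.logb 2 (tC v y₂))) :
    ∃ b : ℕ → ℝ, Tendsto b atTop (𝓝 0) ∧
      ∀ n, ∃ (e₁ : Fin (messageCount n R₁) → (Fin n → S) → (Fin n → X₁))
        (e₂ : Fin (messageCount n R₂) → (Fin n → S) → (Fin n → X₂))
        (d₁ : (Fin n → Y₁) → Fin (messageCount n R₁))
        (d₂ : (Fin n → Y₂) → Fin (messageCount n R₂)),
        (M.pow n).errorProb e₁ e₂ d₁ d₂ ≤ b n := by
  have hr0 : 0 ≤ r :=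
    (sum_logb_density_nonneg M.state_nonneg M.sum_state M.condU_nonneg M.sum_condU).trans hr.le
  have hk0 : 0 ≤ k :=
    (sum_logb_density_nonneg M.state_nonneg M.sum_state M.condV_nonneg M.sum_condV).trans hk.le
  obtain ⟨A, limA⟩ := M.exists_left_tests hR₂ hr0 hk0 hA0 hB0 hA hB hA1 hB1 h₁
  obtain ⟨C, limC⟩ := M.exists_right_tests hk0 hC0 hC hC1 h₂
  obtain ⟨τU, θU, hθU, hτU, limU⟩ :=
    exists_cover_parameters M.state_nonneg M.sum_state M.condU_nonneg M.sum_condU hr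
  obtain ⟨τV, θV, hθV, hτV, limV⟩ :=
    exists_cover_parameters M.state_nonneg M.sum_state M.condV_nonneg M.sum_condV hk
  have lim := ((limA.add limC).add limU).add limV
  simp only [add_zero] at lim
  refine ⟨_, lim, fun n => ?_⟩
  have i1 : Nonempty (Fin (messageCount n R₁)) := ⟨⟨0, messageCount_pos n R₁⟩⟩
  have i2 : Nonempty (Fin (messageCount n R₂)) := ⟨⟨0, messageCount_pos n R₂⟩⟩
  have i3 : Nonempty (Fin (messageCount n r)) := ⟨⟨0, messageCount_pos n r⟩⟩
  have i4 : Nonempty (Fin (messageCount n k)) := ⟨⟨0, messageCount_pos n k⟩⟩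
  obtain ⟨e₁, e₂, d₁, d₂, h⟩ := (M.pow n).exists_code (W₁ := Fin (messageCount n R₁))
    (W₂ := Fin (messageCount n R₂)) (κ₁ := Fin (messageCount n r)) (κ₂ := Fin (messageCount n k))
    (A n) (C n) (hθU n) (τU := τU n) (by simpa using hτU n) (hθV n) (τV := τV n)
    (by simpa using hτV n)
  refine ⟨e₁, e₂, d₁, d₂, h.trans (le_of_eq ?_)⟩
  have dU : ∀ s u, (M.pow n).densityU s u = ∏ i, M.densityU (s i) (u i) := fun s u =>
    density_pow n s u
  have dV : ∀ s v, (M.pow n).densityV s v = ∏ i, M.densityV (s i) (v i) := fun s v =>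
    density_pow n s v
  simp only [failureBound_eq, Fintype.card_fin, dU, dV]
  rfl

end BinningModel

/-! ### Laws of random variables and information densities -/

section Law

variable {Ω α β γ : Type*} [Fintype Ω] {p : Ω → ℝ}

theorem law_eq_sum_ind (p : Ω → ℝ) (A : Ω → α) (a : α) :
    law p A a = ∑ ω, p ω * ind (A ω = a) := by
  unfold law ind
  exact sum_congr rfl fun ω _ => by split_ifs <;> simp

theorem law_nonneg (hp : ∀ ω, 0 ≤ p ω) (A : Ω → α) (a : α) : 0 ≤ law p A a :=
  sum_nonneg fun ω _ => by split_ifs <;> simp [hp]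

theorem law_mono (hp : ∀ ω, 0 ≤ p ω) {A : Ω → α} {B : Ω → β} {a : α} {b : β}
    (h : ∀ ω, A ω = a → B ω = b) : law p A a ≤ law p B b := by
  unfold law
  refine sum_le_sum fun ω _ => ?_
  by_cases hA : A ω = a
  · simp [hA, h ω hA]
  · by_cases hB : B ω = b <;> simp [hA, hB, hp]

theorem law_congr {A : Ω → α} {B : Ω → β} {a : α} {b : β}
    (h : ∀ ω, A ω = a ↔ B ω = b) : law p A a = law p B b := by
  rw [law_eq_sum_ind, law_eq_sum_ind]
  exact sum_congr rfl fun ω _ => by rw [propext (h ω)]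

theorem law_self_pos (hp : ∀ ω, 0 ≤ p ω) {ω : Ω} (hω : p ω ≠ 0) (A : Ω → α) :
    0 < law p A (A ω) := by
  have h1 : 0 < p ω := (hp ω).lt_of_ne' hω
  refine h1.trans_le ?_
  rw [law_eq_sum_ind]
  refine le_trans (le_of_eq ?_) (single_le_sum (f := fun ω' => p ω' * ind (A ω' = A ω))
    (fun ω' _ => mul_nonneg (hp _) (ind_nonneg _)) (mem_univ ω))
  simp [ind]

theorem sum_law_mul [Fintype α] (p : Ω → ℝ) (A : Ω → α) (g : α → ℝ) :
    ∑ a, law p A a * g a = ∑ ω, p ω * g (A ω) := by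
  classical
  unfold law
  simp only [sum_mul]
  rw [sum_comm]
  refine sum_congr rfl fun ω _ => ?_
  rw [sum_eq_single (A ω)]
  · simp
  · intro b _ hb
    simp [hb.symm]
  · simp

theorem sum_law [Fintype α] (p : Ω → ℝ) (A : Ω → α) : ∑ a, law p A a = ∑ ω, p ω := by
  simpa using sum_law_mul p A fun _ => 1

theorem sum_law_fst [Fintype α] (p : Ω → ℝ) (A : Ω → α) (B : Ω → β) (b : β) :
    ∑ a, law p (fun ω => (A ω, B ω)) (a, b) = law p B b := by
  classical
  unfold law
  rw [sum_comm]
  refine sum_congr rfl fun ω _ => ?_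
  rw [sum_eq_single (A ω)]
  · simp
  · intro a _ ha
    simp [ha.symm]
  · simp

theorem mutualInfo_eq_sum [Fintype α] [Fintype β] (p : Ω → ℝ) (A : Ω → α) (B : Ω → β) :
    mutualInfo p A B = ∑ ω, p ω * Real.logb 2 (law p (fun ω => (A ω, B ω)) (A ω, B ω) /
      (law p A (A ω) * law p B (B ω))) := by
  unfold mutualInfo
  rw [← sum_law_mul p (fun ω => (A ω, B ω)) (fun x =>
    Real.logb 2 (law p (fun ω => (A ω, B ω)) x / (law p A x.1 * law p B x.2))),
    Fintype.sum_prod_type]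

theorem condMutualInfo_eq_sum [Fintype α] [Fintype β] [Fintype γ] (p : Ω → ℝ) (A : Ω → α)
    (B : Ω → β) (C : Ω → γ) :
    condMutualInfo p A B C = ∑ ω, p ω * Real.logb 2
      (law p (fun ω => (A ω, B ω, C ω)) (A ω, B ω, C ω) * law p C (C ω) /
      (law p (fun ω => (A ω, C ω)) (A ω, C ω) * law p (fun ω => (B ω, C ω)) (B ω, C ω))) := by
  unfold condMutualInfo
  rw [← sum_law_mul p (fun ω => (A ω, B ω, C ω)) (fun x =>
    Real.logb 2 (law p (fun ω => (A ω, B ω, C ω)) x * law p C x.2.2 /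
      (law p (fun ω => (A ω, C ω)) (x.1, x.2.2) * law p (fun ω => (B ω, C ω)) (x.2.1, x.2.2)))),
    Fintype.sum_prod_type]
  exact sum_congr rfl fun a _ => by rw [Fintype.sum_prod_type]

/-! ### Change of the sample space -/

section Transport

variable {Ω' : Type*} [Fintype Ω'] {J : Ω' → ℝ} {Z : Ω → Ω'}

/-- The hypothesis says, by means of test functions, that `J` is the image of `p` under `Z`. -/
theorem law_comp (hZ : ∀ f : Ω' → ℝ, ∑ ω, p ω * f (Z ω) = ∑ ω, J ω * f ω) (A : Ω' → α) :
    law p (fun ω => A (Z ω)) = law J A := by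
  ext a
  rw [law_eq_sum_ind, law_eq_sum_ind, ← hZ]

theorem mutualInfo_comp [Fintype α] [Fintype β]
    (hZ : ∀ f : Ω' → ℝ, ∑ ω, p ω * f (Z ω) = ∑ ω, J ω * f ω) (A : Ω' → α) (B : Ω' → β) :
    mutualInfo p (fun ω => A (Z ω)) (fun ω => B (Z ω)) = mutualInfo J A B := by
  unfold mutualInfo
  rw [law_comp hZ A, law_comp hZ B, law_comp hZ (fun ω => (A ω, B ω))]

theorem condMutualInfo_comp [Fintype α] [Fintype β] [Fintype γ]
    (hZ : ∀ f : Ω' → ℝ, ∑ ω, p ω * f (Z ω) = ∑ ω, J ω * f ω) (A : Ω' → α) (B : Ω' → β)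
    (C : Ω' → γ) :
    condMutualInfo p (fun ω => A (Z ω)) (fun ω => B (Z ω)) (fun ω => C (Z ω)) =
      condMutualInfo J A B C := by
  unfold condMutualInfo
  rw [law_comp hZ C, law_comp hZ (fun ω => (A ω, B ω, C ω)), law_comp hZ (fun ω => (A ω, C ω)),
    law_comp hZ (fun ω => (B ω, C ω))]

end Transport

/-- The information density of the pair `A`, `B`. -/
noncomputable def infoDensity (p : Ω → ℝ) (A : Ω → α) (B : Ω → β) (a : α) (b : β) : ℝ :=
  law p (fun ω => (A ω, B ω)) (a, b) / (law p A a * law p B b)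

/-- The conditional information density of the pair `A`, `B` given `C`. -/
noncomputable def condInfoDensity (p : Ω → ℝ) (A : Ω → α) (B : Ω → β) (C : Ω → γ)
    (a : α) (b : β) (c : γ) : ℝ :=
  law p (fun ω => (A ω, B ω, C ω)) (a, b, c) * law p C c /
    (law p (fun ω => (A ω, C ω)) (a, c) * law p (fun ω => (B ω, C ω)) (b, c))

theorem infoDensity_nonneg (hp : ∀ ω, 0 ≤ p ω) (A : Ω → α) (B : Ω → β) (a : α) (b : β) :
    0 ≤ infoDensity p A B a b :=
  div_nonneg (law_nonneg hp _ _) (mul_nonneg (law_nonneg hp _ _) (law_nonneg hp _ _))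

theorem condInfoDensity_nonneg (hp : ∀ ω, 0 ≤ p ω) (A : Ω → α) (B : Ω → β) (C : Ω → γ)
    (a : α) (b : β) (c : γ) : 0 ≤ condInfoDensity p A B C a b c :=
  div_nonneg (mul_nonneg (law_nonneg hp _ _) (law_nonneg hp _ _))
    (mul_nonneg (law_nonneg hp _ _) (law_nonneg hp _ _))

theorem infoDensity_pos (hp : ∀ ω, 0 ≤ p ω) {ω : Ω} (hω : p ω ≠ 0) (A : Ω → α) (B : Ω → β) :
    0 < infoDensity p A B (A ω) (B ω) :=
  div_pos (law_self_pos hp hω fun ω => (A ω, B ω))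
    (mul_pos (law_self_pos hp hω A) (law_self_pos hp hω B))

theorem condInfoDensity_pos (hp : ∀ ω, 0 ≤ p ω) {ω : Ω} (hω : p ω ≠ 0) (A : Ω → α) (B : Ω → β)
    (C : Ω → γ) : 0 < condInfoDensity p A B C (A ω) (B ω) (C ω) :=
  div_pos (mul_pos (law_self_pos hp hω fun ω => (A ω, B ω, C ω)) (law_self_pos hp hω C))
    (mul_pos (law_self_pos hp hω fun ω => (A ω, C ω)) (law_self_pos hp hω fun ω => (B ω, C ω)))

theorem sum_law_mul_infoDensity_le [Fintype α] [Fintype β] (hp : ∀ ω, 0 ≤ p ω)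
    (hp1 : ∑ ω, p ω = 1) (A : Ω → α) (B : Ω → β) :
    ∑ a, law p A a * ∑ b, law p B b * infoDensity p A B a b ≤ 1 := by
  rw [← hp1, ← sum_law p (fun ω => (A ω, B ω)), Fintype.sum_prod_type]
  refine sum_le_sum fun a _ => ?_
  rw [mul_sum]
  refine sum_le_sum fun b _ => ?_
  unfold infoDensity
  rw [← mul_assoc]
  by_cases h : law p A a * law p B b = 0
  · rw [h, zero_mul]; exact law_nonneg hp _ _
  · rw [mul_div_cancel₀ _ h]

/-- The information density for a false first codeword and a true second one. -/
noncomputable def leftDensity {δ : Type*} (p : Ω → ℝ) (A₁ : Ω → α) (A₂ : Ω → β) (V : Ω → γ)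
    (Y : Ω → δ) (a : α × β) (v : γ) (y : δ) : ℝ :=
  infoDensity p A₁ Y a.1 y * condInfoDensity p A₂ (fun ω => (V ω, Y ω)) A₁ a.2 (v, y) a.1

/-- On the support, P(u₁,u₂) P(v,y) times the density is P(v,y) P(u₁|y) P(u₂|u₁,v,y). Summing over
u₂, then u₁, then (v,y) leaves at most one. This ratio is chosen instead of the full density of
(U₁,U₂) and (V,Y) because its logarithm has mean exactly I(U₁;Y) + I(U₂;VY|U₁). -/
theorem sum_law_mul_leftDensity_le {δ : Type*} [Fintype α] [Fintype β] [Fintype γ] [Fintype δ]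
    (hp : ∀ ω, 0 ≤ p ω) (hp1 : ∑ ω, p ω = 1) (A₁ : Ω → α) (A₂ : Ω → β) (V : Ω → γ) (Y : Ω → δ) :
    ∑ a, law p (fun ω => (A₁ ω, A₂ ω)) a * ∑ x, law p (fun ω => (V ω, Y ω)) x *
      leftDensity p A₁ A₂ V Y a x.1 x.2 ≤ 1 := by
  have hswap : ∀ a₁ a₂, law p (fun ω => (A₁ ω, A₂ ω)) (a₁, a₂) =
      law p (fun ω => (A₂ ω, A₁ ω)) (a₂, a₁) := fun a₁ a₂ => law_congr fun ω => by
    simp only [Prod.mk.injEq]; tauto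
  set K : β → γ × δ → α → ℝ := fun a₂ x a₁ =>
    law p (fun ω => (A₂ ω, (V ω, Y ω), A₁ ω)) (a₂, x, a₁) with hK
  set vy : γ × δ → ℝ := law p (fun ω => (V ω, Y ω))
  set ay : α → δ → ℝ := fun a y => law p (fun ω => (A₁ ω, Y ω)) (a, y) with hay
  set vya : γ × δ → α → ℝ := fun x a => law p (fun ω => ((V ω, Y ω), A₁ ω)) (x, a) with hvya
  have h1 : ∀ a₁ a₂ x, law p (fun ω => (A₁ ω, A₂ ω)) (a₁, a₂) * (vy x *
      leftDensity p A₁ A₂ V Y (a₁, a₂) x.1 x.2) ≤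
      vy x * ay a₁ x.2 / (law p Y x.2 * vya x a₁) * K a₂ x a₁ := by
    intro a₁ a₂ x
    rw [hswap]
    unfold leftDensity infoDensity condInfoDensity
    simp only [Prod.mk.eta]
    -- Where the joint mass vanishes both sides are zero. Elsewhere the denominators are positive,
    -- as the mass of a larger event.
    rcases (law_nonneg hp (fun ω => (A₂ ω, (V ω, Y ω), A₁ ω)) (a₂, x, a₁)).eq_or_lt' with h | h
    · simp [hK, h]
    · have p1 : 0 < law p A₁ a₁ := h.trans_le (law_mono hp fun ω hω => by
        simp only [Prod.ext_iff] at hω; tauto)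
      have p2 : 0 < law p Y x.2 := h.trans_le (law_mono hp fun ω hω => by
        simp only [Prod.ext_iff] at hω; tauto)
      have p3 : 0 < law p (fun ω => (A₂ ω, A₁ ω)) (a₂, a₁) :=
        h.trans_le (law_mono hp fun ω hω => by simp only [Prod.ext_iff] at hω ⊢; tauto)
      have p4 : 0 < law p (fun ω => ((V ω, Y ω), A₁ ω)) (x, a₁) :=
        h.trans_le (law_mono hp fun ω hω => by simp only [Prod.ext_iff] at hω ⊢; tauto)
      refine le_of_eq ?_
      simp only [hK, hay, hvya]
      field_simp
  have h2 : ∀ a₁ x, ∑ a₂, vy x * ay a₁ x.2 / (law p Y x.2 * vya x a₁) * K a₂ x a₁ ≤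
      vy x / law p Y x.2 * ay a₁ x.2 := by
    intro a₁ x
    rw [← mul_sum]
    have hs : ∑ a₂, K a₂ x a₁ = vya x a₁ :=
      sum_law_fst p A₂ (fun ω => ((V ω, Y ω), A₁ ω)) (x, a₁)
    rw [hs]
    have n1 : 0 ≤ vy x / law p Y x.2 * ay a₁ x.2 :=
      mul_nonneg (div_nonneg (law_nonneg hp _ _) (law_nonneg hp _ _)) (law_nonneg hp _ _)
    by_cases h : vya x a₁ = 0
    · rw [h, mul_zero]; exact n1
    · refine le_of_eq ?_
      rw [mul_div_mul_comm, mul_div_assoc', mul_div_right_comm]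
      field_simp
  have h3 : ∀ x, ∑ a₁, vy x / law p Y x.2 * ay a₁ x.2 ≤ vy x := by
    intro x
    rw [← mul_sum]
    have hs : ∑ a₁, ay a₁ x.2 = law p Y x.2 := sum_law_fst p A₁ Y x.2
    rw [hs, div_mul_comm]
    by_cases h : law p Y x.2 = 0
    · rw [h]; simpa using law_nonneg hp (fun ω => (V ω, Y ω)) x
    · rw [div_self h, one_mul]
  calc _ = ∑ x, ∑ a₁, ∑ a₂, law p (fun ω => (A₁ ω, A₂ ω)) (a₁, a₂) * (vy x *
      leftDensity p A₁ A₂ V Y (a₁, a₂) x.1 x.2) := by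
        simp only [mul_sum]
        rw [sum_comm]
        exact sum_congr rfl fun x _ => Fintype.sum_prod_type _
    _ ≤ ∑ x, vy x := sum_le_sum fun x _ => (sum_le_sum fun a₁ _ =>
        (sum_le_sum fun a₂ _ => h1 a₁ a₂ x).trans (h2 a₁ x)).trans (h3 x)
    _ = 1 := by rw [sum_law, hp1]

/-- The information density for a false first codeword and a false second one. -/
noncomputable def jointDensity {δ : Type*} (p : Ω → ℝ) (A₁ : Ω → α) (A₂ : Ω → β) (V : Ω → γ)
    (Y : Ω → δ) (a : α × β) (v : γ) (y : δ) : ℝ :=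
  leftDensity p A₁ A₂ V Y a v y * infoDensity p V (fun ω => (A₁ ω, Y ω)) v (a.1, y)

/-- On the support the factors cancel to P(u,v,y) / (P(u) P(v) P(y)), so the sum is bounded by the
total joint mass. -/
theorem sum_law_mul_jointDensity_le {δ : Type*} [Fintype α] [Fintype β] [Fintype γ] [Fintype δ]
    (hp : ∀ ω, 0 ≤ p ω) (hp1 : ∑ ω, p ω = 1) (A₁ : Ω → α) (A₂ : Ω → β) (V : Ω → γ) (Y : Ω → δ) :
    ∑ a, law p (fun ω => (A₁ ω, A₂ ω)) a * ∑ v, law p V v * ∑ y, law p Y y *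
      jointDensity p A₁ A₂ V Y a v y ≤ 1 := by
  have hswap : ∀ a₁ a₂, law p (fun ω => (A₁ ω, A₂ ω)) (a₁, a₂) =
      law p (fun ω => (A₂ ω, A₁ ω)) (a₂, a₁) := fun a₁ a₂ => law_congr fun ω => by
    simp only [Prod.mk.injEq]; tauto
  -- The mass of (V, A₁, Y) occurs in two bracketings, which must be identified before it cancels.
  have hassoc : ∀ v a₁ y, law p (fun ω => (V ω, A₁ ω, Y ω)) (v, a₁, y) =
      law p (fun ω => ((V ω, Y ω), A₁ ω)) ((v, y), a₁) := fun v a₁ y => law_congr fun ω => by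
    simp only [Prod.mk.injEq]; tauto
  have hre : ∑ x, law p (fun ω => ((A₁ ω, A₂ ω), V ω, Y ω)) x = 1 := by rw [sum_law, hp1]
  rw [← hre, Fintype.sum_prod_type (fun x => law p (fun ω => ((A₁ ω, A₂ ω), V ω, Y ω)) x)]
  refine sum_le_sum fun a _ => ?_
  rw [Fintype.sum_prod_type, mul_sum]
  refine sum_le_sum fun v _ => ?_
  rw [mul_sum, mul_sum]
  refine sum_le_sum fun y _ => ?_
  obtain ⟨a₁, a₂⟩ := a
  have hK : law p (fun ω => ((A₁ ω, A₂ ω), V ω, Y ω)) ((a₁, a₂), v, y) =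
      law p (fun ω => (A₂ ω, (V ω, Y ω), A₁ ω)) (a₂, (v, y), a₁) := law_congr fun ω => by
    simp only [Prod.mk.injEq]; tauto
  rw [hswap, hK]
  unfold jointDensity leftDensity infoDensity condInfoDensity
  simp only [hassoc]
  rcases (law_nonneg hp (fun ω => (A₂ ω, (V ω, Y ω), A₁ ω)) (a₂, (v, y), a₁)).eq_or_lt' with h | h
  · simp [h]
  · have p1 : 0 < law p A₁ a₁ := h.trans_le (law_mono hp fun ω hω => by
      simp only [Prod.ext_iff] at hω; tauto)
    have p2 : 0 < law p Y y := h.trans_le (law_mono hp fun ω hω => by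
      simp only [Prod.ext_iff] at hω; tauto)
    have p3 : 0 < law p (fun ω => (A₂ ω, A₁ ω)) (a₂, a₁) :=
      h.trans_le (law_mono hp fun ω hω => by simp only [Prod.ext_iff] at hω ⊢; tauto)
    have p4 : 0 < law p (fun ω => ((V ω, Y ω), A₁ ω)) ((v, y), a₁) :=
      h.trans_le (law_mono hp fun ω hω => by simp only [Prod.ext_iff] at hω ⊢; tauto)
    have p5 : 0 < law p V v := h.trans_le (law_mono hp fun ω hω => by
      simp only [Prod.ext_iff] at hω; tauto)
    have p6 : 0 < law p (fun ω => (A₁ ω, Y ω)) (a₁, y) :=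
      h.trans_le (law_mono hp fun ω hω => by simp only [Prod.ext_iff] at hω ⊢; tauto)
    refine le_of_eq ?_
    field_simp

theorem sum_mul_logb_infoDensity [Fintype α] [Fintype β] (p : Ω → ℝ) (A : Ω → α) (B : Ω → β) :
    ∑ ω, p ω * Real.logb 2 (infoDensity p A B (A ω) (B ω)) = mutualInfo p A B :=
  (mutualInfo_eq_sum p A B).symm

theorem leftDensity_pos {δ : Type*} (hp : ∀ ω, 0 ≤ p ω) {ω : Ω} (hω : p ω ≠ 0) (A₁ : Ω → α)
    (A₂ : Ω → β) (V : Ω → γ) (Y : Ω → δ) :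
    0 < leftDensity p A₁ A₂ V Y (A₁ ω, A₂ ω) (V ω) (Y ω) :=
  mul_pos (infoDensity_pos hp hω A₁ Y) (condInfoDensity_pos hp hω A₂ (fun ω => (V ω, Y ω)) A₁)

theorem jointDensity_pos {δ : Type*} (hp : ∀ ω, 0 ≤ p ω) {ω : Ω} (hω : p ω ≠ 0) (A₁ : Ω → α)
    (A₂ : Ω → β) (V : Ω → γ) (Y : Ω → δ) :
    0 < jointDensity p A₁ A₂ V Y (A₁ ω, A₂ ω) (V ω) (Y ω) :=
  mul_pos (leftDensity_pos hp hω A₁ A₂ V Y) (infoDensity_pos hp hω V fun ω => (A₁ ω, Y ω))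

theorem sum_mul_logb_leftDensity {δ : Type*} [Fintype α] [Fintype β] [Fintype γ] [Fintype δ]
    (hp : ∀ ω, 0 ≤ p ω) (A₁ : Ω → α) (A₂ : Ω → β) (V : Ω → γ) (Y : Ω → δ) :
    ∑ ω, p ω * Real.logb 2 (leftDensity p A₁ A₂ V Y (A₁ ω, A₂ ω) (V ω) (Y ω)) =
      mutualInfo p A₁ Y + condMutualInfo p A₂ (fun ω => (V ω, Y ω)) A₁ := by
  rw [mutualInfo_eq_sum, condMutualInfo_eq_sum, ← sum_add_distrib]
  refine sum_congr rfl fun ω _ => ?_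
  by_cases hω : p ω = 0
  · simp [hω]
  · unfold leftDensity
    rw [Real.logb_mul (infoDensity_pos hp hω A₁ Y).ne'
      (condInfoDensity_pos hp hω A₂ (fun ω => (V ω, Y ω)) A₁).ne', mul_add]
    rfl

theorem sum_mul_logb_jointDensity {δ : Type*} [Fintype α] [Fintype β] [Fintype γ] [Fintype δ]
    (hp : ∀ ω, 0 ≤ p ω) (A₁ : Ω → α) (A₂ : Ω → β) (V : Ω → γ) (Y : Ω → δ) :
    ∑ ω, p ω * Real.logb 2 (jointDensity p A₁ A₂ V Y (A₁ ω, A₂ ω) (V ω) (Y ω)) =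
      mutualInfo p A₁ Y + condMutualInfo p A₂ (fun ω => (V ω, Y ω)) A₁ +
        mutualInfo p V (fun ω => (A₁ ω, Y ω)) := by
  rw [← sum_mul_logb_leftDensity hp, mutualInfo_eq_sum, ← sum_add_distrib]
  refine sum_congr rfl fun ω _ => ?_
  by_cases hω : p ω = 0
  · simp [hω]
  · unfold jointDensity
    rw [Real.logb_mul (leftDensity_pos hp hω A₁ A₂ V Y).ne'
      (infoDensity_pos hp hω V fun ω => (A₁ ω, Y ω)).ne', mul_add]
    rfl

end Law

theorem sum_mul_ind_eq {α : Type*} [Fintype α] (f : α → ℝ) (b : α) :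
    ∑ a, f a * ind (a = b) = f b := by
  rw [sum_eq_single b]
  · rw [ind_of rfl, mul_one]
  · intro a _ h
    rw [ind_of_not h, mul_zero]
  · simp

/-! ### Marginals of the joint law and rate conditions in terms of mutual information -/

namespace BinningModel

variable {S U V X₁ X₂ Y₁ Y₂ : Type*} [Fintype S] [Fintype U] [Fintype V]
    [Fintype X₁] [Fintype X₂] [Fintype Y₁] [Fintype Y₂] (M : BinningModel S U V X₁ X₂ Y₁ Y₂)

theorem sum_joint_mul_left (f : S → U → ℝ) :
    ∑ ω, M.joint ω * f ω.1 ω.2.1 = ∑ s, ∑ u, M.state s * M.condU s u * f s u := by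
  simp only [Fintype.sum_prod_type, joint, ← sum_mul, ← mul_sum, M.sum_kernel, M.sum_condV]
  exact sum_congr rfl fun s _ => sum_congr rfl fun u _ => by ring

theorem sum_joint_mul_right (f : S → V → ℝ) :
    ∑ ω, M.joint ω * f ω.1 ω.2.2.1 = ∑ s, ∑ v, M.state s * M.condV s v * f s v := by
  simp only [Fintype.sum_prod_type, joint]
  refine sum_congr rfl fun s _ => ?_
  rw [sum_comm]
  refine sum_congr rfl fun v _ => ?_
  simp only [← sum_mul, ← mul_sum, M.sum_kernel, M.sum_condU]
  ring

theorem sum_joint_mul_state (f : S → ℝ) : ∑ ω, M.joint ω * f ω.1 = ∑ s, M.state s * f s := by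
  rw [M.sum_joint_mul_left (fun s _ => f s)]
  simp only [← sum_mul, ← mul_sum, M.sum_condU, mul_one]

theorem law_joint_state (s : S) : law M.joint (fun ω => ω.1) s = M.state s := by
  rw [law_eq_sum_ind, M.sum_joint_mul_state (fun s' => ind (s' = s)), sum_mul_ind_eq]

theorem law_joint_left (u : U) : law M.joint (fun ω => ω.2.1) u = M.lawU u := by
  rw [law_eq_sum_ind, M.sum_joint_mul_left (fun _ u' => ind (u' = u))]
  exact sum_congr rfl fun s _ => sum_mul_ind_eq (fun u => M.state s * M.condU s u) u

theorem law_joint_right (v : V) : law M.joint (fun ω => ω.2.2.1) v = M.lawV v := by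
  rw [law_eq_sum_ind, M.sum_joint_mul_right (fun _ v' => ind (v' = v))]
  exact sum_congr rfl fun s _ => sum_mul_ind_eq (fun v => M.state s * M.condV s v) v

/-- The mass of the state cancels in the ratio of the joint law to the product of the marginals,
which leaves the density that governs the selection. -/
theorem mutualInfo_state_left : mutualInfo M.joint (fun ω => ω.1) (fun ω => ω.2.1) =
    ∑ s, ∑ u, M.state s * M.condU s u * Real.logb 2 (M.densityU s u) := by
  have h : ∀ s u, law M.joint (fun ω => (ω.1, ω.2.1)) (s, u) = M.state s * M.condU s u := by
    intro s u
    rw [law_eq_sum_ind, M.sum_joint_mul_left (fun s' u' => ind ((s', u') = (s, u))),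
      ← Fintype.sum_prod_type']
    exact sum_mul_ind_eq (fun x : S × U => M.state x.1 * M.condU x.1 x.2) (s, u)
  rw [mutualInfo_eq_sum]
  simp only [h, law_joint_state, law_joint_left]
  rw [M.sum_joint_mul_left
    (fun s u => Real.logb 2 (M.state s * M.condU s u / (M.state s * M.lawU u)))]
  refine sum_congr rfl fun s _ => sum_congr rfl fun u _ => ?_
  by_cases hs : M.state s = 0
  · simp [hs]
  · rw [mul_div_mul_left _ _ hs]
    rfl

theorem mutualInfo_state_right : mutualInfo M.joint (fun ω => ω.1) (fun ω => ω.2.2.1) =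
    ∑ s, ∑ v, M.state s * M.condV s v * Real.logb 2 (M.densityV s v) := by
  have h : ∀ s v, law M.joint (fun ω => (ω.1, ω.2.2.1)) (s, v) = M.state s * M.condV s v := by
    intro s v
    rw [law_eq_sum_ind, M.sum_joint_mul_right (fun s' v' => ind ((s', v') = (s, v))),
      ← Fintype.sum_prod_type']
    exact sum_mul_ind_eq (fun x : S × V => M.state x.1 * M.condV x.1 x.2) (s, v)
  rw [mutualInfo_eq_sum]
  simp only [h, law_joint_state, law_joint_right]
  rw [M.sum_joint_mul_right
    (fun s v => Real.logb 2 (M.state s * M.condV s v / (M.state s * M.lawV v)))]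
  refine sum_congr rfl fun s _ => sum_congr rfl fun v _ => ?_
  by_cases hs : M.state s = 0
  · simp [hs]
  · rw [mul_div_mul_left _ _ hs]
    rfl

/-- Codes for a model in which `U` is a pair, under conditions on the rates in terms of mutual
informations. -/
theorem exists_codes_of_mutualInfo {U₁ U₂ : Type*} [Fintype U₁] [Fintype U₂]
    (M : BinningModel S (U₁ × U₂) V X₁ X₂ Y₁ Y₂) {R₁ R₂ r k : ℝ} (hR₂ : 0 ≤ R₂)
    (hr : mutualInfo M.joint (fun ω => ω.1) (fun ω => ω.2.1) < r)
    (hk : mutualInfo M.joint (fun ω => ω.1) (fun ω => ω.2.2.1) < k)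
    (h₁ : R₁ = 0 ∨ (R₁ + r < mutualInfo M.joint (fun ω => ω.2.1.1) (fun ω => ω.2.2.2.1) +
        condMutualInfo M.joint (fun ω => ω.2.1.2) (fun ω => (ω.2.2.1, ω.2.2.2.1))
          (fun ω => ω.2.1.1) ∧
      R₁ + r + R₂ + k < mutualInfo M.joint (fun ω => ω.2.1.1) (fun ω => ω.2.2.2.1) +
        condMutualInfo M.joint (fun ω => ω.2.1.2) (fun ω => (ω.2.2.1, ω.2.2.2.1))
          (fun ω => ω.2.1.1) +
        mutualInfo M.joint (fun ω => ω.2.2.1) (fun ω => (ω.2.1.1, ω.2.2.2.1))))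
    (h₂ : R₂ = 0 ∨ R₂ + k < mutualInfo M.joint (fun ω => ω.2.2.1) (fun ω => ω.2.2.2.2)) :
    ∃ b : ℕ → ℝ, Tendsto b atTop (𝓝 0) ∧
      ∀ n, ∃ (e₁ : Fin (messageCount n R₁) → (Fin n → S) → (Fin n → X₁))
        (e₂ : Fin (messageCount n R₂) → (Fin n → S) → (Fin n → X₂))
        (d₁ : (Fin n → Y₁) → Fin (messageCount n R₁))
        (d₂ : (Fin n → Y₂) → Fin (messageCount n R₂)),
        (M.pow n).errorProb e₁ e₂ d₁ d₂ ≤ b n := by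
  have hJ := M.joint_nonneg
  have hJ1 := M.sum_joint
  rw [mutualInfo_state_left] at hr
  rw [mutualInfo_state_right] at hk
  rw [← sum_mul_logb_jointDensity hJ, ← sum_mul_logb_leftDensity hJ] at h₁
  rw [← sum_mul_logb_infoDensity] at h₂
  refine M.exists_codes hR₂
    (tA := leftDensity M.joint (fun ω => ω.2.1.1) (fun ω => ω.2.1.2) (fun ω => ω.2.2.1)
      (fun ω => ω.2.2.2.1))
    (tB := jointDensity M.joint (fun ω => ω.2.1.1) (fun ω => ω.2.1.2) (fun ω => ω.2.2.1)
      (fun ω => ω.2.2.2.1))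
    (tC := infoDensity M.joint (fun ω => ω.2.2.1) (fun ω => ω.2.2.2.2))
    (fun _ _ _ => mul_nonneg (infoDensity_nonneg hJ _ _ _ _)
      (condInfoDensity_nonneg hJ _ _ _ _ _ _))
    (fun _ _ _ => mul_nonneg (mul_nonneg (infoDensity_nonneg hJ _ _ _ _)
      (condInfoDensity_nonneg hJ _ _ _ _ _ _)) (infoDensity_nonneg hJ _ _ _ _))
    (infoDensity_nonneg hJ _ _)
    (fun ω hω => leftDensity_pos hJ hω (fun ω => ω.2.1.1) (fun ω => ω.2.1.2) (fun ω => ω.2.2.1)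
      (fun ω => ω.2.2.2.1))
    (fun ω hω => jointDensity_pos hJ hω (fun ω => ω.2.1.1) (fun ω => ω.2.1.2) (fun ω => ω.2.2.1)
      (fun ω => ω.2.2.2.1))
    (fun ω hω => infoDensity_pos hJ hω (fun ω => ω.2.2.1) (fun ω => ω.2.2.2.2))
    ?_ ?_ ?_ hr hk h₁ h₂
  · refine le_trans (le_of_eq ?_) (sum_law_mul_leftDensity_le hJ hJ1 (fun ω => ω.2.1.1)
      (fun ω => ω.2.1.2) (fun ω => ω.2.2.1) (fun ω => ω.2.2.2.1))
    refine sum_congr rfl fun u' _ => ?_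
    -- For a fixed false codeword the test depends only on the true V and Y₁, so the mean under the
    -- joint law is a mean under the law of that pair.
    rw [← law_joint_left, sum_law_mul]
    rfl
  · refine le_trans (le_of_eq ?_) (sum_law_mul_jointDensity_le hJ hJ1 (fun ω => ω.2.1.1)
      (fun ω => ω.2.1.2) (fun ω => ω.2.2.1) (fun ω => ω.2.2.2.1))
    refine sum_congr rfl fun u' _ => ?_
    rw [← law_joint_left]
    refine congrArg₂ (· * ·) rfl (sum_congr rfl fun v' _ => ?_)
    rw [← law_joint_right, sum_law_mul]
    rfl
  · refine le_trans (le_of_eq ?_) (sum_law_mul_infoDensity_le hJ hJ1 (fun ω => ω.2.2.1)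
      (fun ω => ω.2.2.2.2))
    refine sum_congr rfl fun v' _ => ?_
    rw [← law_joint_right, sum_law_mul]
    rfl

end BinningModel

/-! ### The Z-interference channel -/

theorem sum_toReal_eq_one {α : Type*} [Fintype α] (p : PMF α) : ∑ a, (p a).toReal = 1 := by
  have h := p.tsum_coe
  rw [tsum_fintype] at h
  rw [← ENNReal.toReal_sum fun a _ => p.apply_ne_top a, h, ENNReal.toReal_one]

theorem Code.avgError_nonneg {S₁ S₂ X₁ X₂ Y₁ Y₂ : Type*} [Fintype S₁] [Fintype S₂]
    [Fintype Y₁] [Fintype Y₂] {n M₁ M₂ : ℕ}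
    (C : Code S₁ S₂ X₁ X₂ Y₁ Y₂ n M₁ M₂) (ch : Channel S₁ S₂ X₁ X₂ Y₁ Y₂) : 0 ≤ C.avgError ch := by
  refine mul_nonneg (by positivity) (sum_nonneg fun _ _ => sum_nonneg fun _ _ => ?_)
  refine sum_nonneg fun _ _ => sum_nonneg fun _ _ => sum_nonneg fun _ _ => sum_nonneg fun _ _ => ?_
  split_ifs
  · exact mul_nonneg (prod_nonneg fun _ _ => ENNReal.toReal_nonneg)
      (prod_nonneg fun _ _ => ENNReal.toReal_nonneg)
  · exact le_rfl

variable {S₁ S₂ X₁ X₂ Y₁ Y₂ U₁ U₂ V : Type*}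
    [Fintype S₁] [Fintype S₂] [Fintype X₁] [Fintype X₂] [Fintype Y₁] [Fintype Y₂]
    [Fintype U₁] [Fintype U₂] [Fintype V]

/-- The binning model of a Z-interference channel in which the encoders use only the first
state. -/
noncomputable def ZChannel.binningModel (z : ZChannel S₁ S₂ X₁ X₂ Y₁ Y₂)
    (q : InputLaws S₁ X₁ X₂ U₁ U₂ V) : BinningModel S₁ (U₁ × U₂) V X₁ X₂ Y₁ Y₂ where
  state s := ∑ s₂, (z.state (s, s₂)).toReal
  condU s u := (q.u₁ s u.1).toReal * (q.u₂ s u.1 u.2).toReal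
  condV s v := (q.v s v).toReal
  input₁ s u x := (q.x₁ s u.1 u.2 x).toReal
  input₂ s v x := (q.x₂ v s x).toReal
  out s x₁ x₂ y₁ y₂ := ∑ s₂, (z.state (s, s₂)).toReal *
    ((z.out₁ s x₁ x₂ y₁).toReal * (z.out₂ s₂ x₂ y₂).toReal)
  condU_nonneg _ _ := mul_nonneg ENNReal.toReal_nonneg ENNReal.toReal_nonneg
  condV_nonneg _ _ := ENNReal.toReal_nonneg
  input₁_nonneg _ _ _ := ENNReal.toReal_nonneg
  input₂_nonneg _ _ _ := ENNReal.toReal_nonneg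
  out_nonneg _ _ _ _ _ := sum_nonneg fun _ _ => mul_nonneg ENNReal.toReal_nonneg
    (mul_nonneg ENNReal.toReal_nonneg ENNReal.toReal_nonneg)
  sum_state := by
    rw [← Fintype.sum_prod_type']
    exact sum_toReal_eq_one z.state
  sum_condU s := by
    simp only [Fintype.sum_prod_type, ← mul_sum, sum_toReal_eq_one, mul_one]
  sum_condV s := sum_toReal_eq_one _
  sum_input₁ _ _ := sum_toReal_eq_one _
  sum_input₂ _ _ := sum_toReal_eq_one _
  sum_out s x₁ x₂ := by
    calc ∑ y₁, ∑ y₂, ∑ s₂, (z.state (s, s₂)).toReal *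
          ((z.out₁ s x₁ x₂ y₁).toReal * (z.out₂ s₂ x₂ y₂).toReal)
        = ∑ s₂, ∑ y₁, ∑ y₂, (z.state (s, s₂)).toReal *
          ((z.out₁ s x₁ x₂ y₁).toReal * (z.out₂ s₂ x₂ y₂).toReal) := by
          rw [sum_congr rfl fun y₁ _ => sum_comm, sum_comm]
      _ = _ := by simp only [← mul_sum, sum_toReal_eq_one, mul_one]

/-- The second state and both inputs are summed out. With `f` arbitrary, this identifies an image
law and so carries over every mutual information. -/
theorem sum_jointMass_mul (z : ZChannel S₁ S₂ X₁ X₂ Y₁ Y₂) (q : InputLaws S₁ X₁ X₂ U₁ U₂ V)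
    (f : S₁ × (U₁ × U₂) × V × Y₁ × Y₂ → ℝ) :
    ∑ ω, jointMass z q ω * f (ω.s₁, (ω.u₁, ω.u₂), ω.v, ω.y₁, ω.y₂) =
      ∑ ω, (z.binningModel q).joint ω * f ω := by
  have h := Fintype.sum_equiv
    (⟨fun ω => (ω.1, (ω.2.2.2.2.1, ω.2.2.2.2.2.1), ω.2.2.1, ω.2.2.2.2.2.2.2.1, ω.2.2.2.2.2.2.2.2,
        ω.2.2.2.2.2.2.1, ω.2.2.2.1, ω.2.1),
      fun c => (c.1, c.2.2.2.2.2.2.2, c.2.2.1, c.2.2.2.2.2.2.1, c.2.1.1, c.2.1.2, c.2.2.2.2.2.1,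
        c.2.2.2.1, c.2.2.2.2.1), fun _ => rfl, fun _ => rfl⟩ :
      Outcome S₁ S₂ X₁ X₂ Y₁ Y₂ U₁ U₂ V ≃ S₁ × (U₁ × U₂) × V × Y₁ × Y₂ × X₁ × X₂ × S₂)
    (fun ω => jointMass z q ω * f (ω.s₁, (ω.u₁, ω.u₂), ω.v, ω.y₁, ω.y₂))
    (fun c => (z.binningModel q).condU c.1 c.2.1 * (z.binningModel q).condV c.1 c.2.2.1 *
      ((z.binningModel q).input₁ c.1 c.2.1 c.2.2.2.2.2.1 *
        (z.binningModel q).input₂ c.1 c.2.2.1 c.2.2.2.2.2.2.1 *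
        ((z.state (c.1, c.2.2.2.2.2.2.2)).toReal *
          ((z.out₁ c.1 c.2.2.2.2.2.1 c.2.2.2.2.2.2.1 c.2.2.2.1).toReal *
          (z.out₂ c.2.2.2.2.2.2.2 c.2.2.2.2.2.2.1 c.2.2.2.2.1).toReal))) *
      f (c.1, c.2.1, c.2.2.1, c.2.2.2.1, c.2.2.2.2.1))
    (fun ω => by
      simp only [jointMass, ZChannel.binningModel, Equiv.coe_fn_mk]
      ring)
  rw [h]
  simp only [Fintype.sum_prod_type, BinningModel.joint, BinningModel.kernel]
  simp only [← sum_mul, ← mul_sum]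
  rfl

/-- The encoders ignore the second state sequence, so it is summed out coordinate by coordinate. -/
theorem avgError_eq_errorProb (z : ZChannel S₁ S₂ X₁ X₂ Y₁ Y₂) (q : InputLaws S₁ X₁ X₂ U₁ U₂ V)
    {n M₁ M₂ : ℕ} (e₁ : Fin M₁ → (Fin n → S₁) → (Fin n → X₁))
    (e₂ : Fin M₂ → (Fin n → S₁) → (Fin n → X₂)) (d₁ : (Fin n → Y₁) → Fin M₁)
    (d₂ : (Fin n → Y₂) → Fin M₂) :
    (⟨fun w s _ => e₁ w s, fun w s _ => e₂ w s, d₁, d₂⟩ : Code S₁ S₂ X₁ X₂ Y₁ Y₂ n M₁ M₂).avgError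
      z.toChannel = ((z.binningModel q).pow n).errorProb e₁ e₂ d₁ d₂ := by
  unfold Code.avgError BinningModel.errorProb
  rw [Fintype.card_fin, Fintype.card_fin]
  congr 1
  refine sum_congr rfl fun w₁ _ => sum_congr rfl fun w₂ _ => ?_
  unfold Code.errorProb
  refine sum_congr rfl fun s _ => ?_
  rw [sum_comm]
  refine sum_congr rfl fun y₁ _ => ?_
  rw [sum_comm]
  refine sum_congr rfl fun y₂ _ => ?_
  by_cases h : (d₁ y₁, d₂ y₂) ≠ (w₁, w₂)
  · rw [ind_of h, one_mul]
    simp only [if_pos h]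
    simp only [ZChannel.toChannel_transition_apply, ENNReal.toReal_mul, ← prod_mul_distrib]
    exact sum_prod_apply fun i s₂ => (z.state (s i, s₂)).toReal *
      ((z.out₁ (s i) (e₁ w₁ s i) (e₂ w₂ s i) (y₁ i)).toReal *
        (z.out₂ s₂ (e₂ w₂ s i) (y₂ i)).toReal)
  · rw [ind_of_not h, zero_mul]
    simp only [if_neg h, sum_const_zero]

/-- A zero rate is exempt from strictness, so that boundary points can be approached. The bound
`h₂'` is needed even when R₂ = 0, because the sum condition of the first decoder still contains the
bin rate of V. -/
theorem achievable_of_rate_bounds (z : ZChannel S₁ S₂ X₁ X₂ Y₁ Y₂)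
    (q : InputLaws S₁ X₁ X₂ U₁ U₂ V)
    (hcond : mutualInfo (jointMass z q) (fun ω => ω.v) (fun ω => (ω.u₁, ω.y₁)) ≤
      mutualInfo (jointMass z q) (fun ω => ω.v) (fun ω => ω.y₂))
    {R₁ R₂ : ℝ} (hR₁ : 0 ≤ R₁) (hR₂ : 0 ≤ R₂)
    (h₁ : R₁ = 0 ∨ R₁ < mutualInfo (jointMass z q) (fun ω => ω.u₁) (fun ω => ω.y₁) +
      condMutualInfo (jointMass z q) (fun ω => ω.u₂) (fun ω => (ω.v, ω.y₁)) (fun ω => ω.u₁) -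
      mutualInfo (jointMass z q) (fun ω => ω.s₁) (fun ω => (ω.u₁, ω.u₂)))
    (h₂ : R₂ = 0 ∨ R₂ < mutualInfo (jointMass z q) (fun ω => ω.v) (fun ω => (ω.u₁, ω.y₁)) -
      mutualInfo (jointMass z q) (fun ω => ω.s₁) (fun ω => ω.v))
    (h₂' : R₂ ≤ mutualInfo (jointMass z q) (fun ω => ω.v) (fun ω => (ω.u₁, ω.y₁)) -
      mutualInfo (jointMass z q) (fun ω => ω.s₁) (fun ω => ω.v)) :
    z.toChannel.Achievable (R₁, R₂) := by
  have hZ := sum_jointMass_mul z q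
  set J := (z.binningModel q).joint with hJ
  have m₁ : mutualInfo (jointMass z q) (fun ω => ω.u₁) (fun ω => ω.y₁) =
      mutualInfo J (fun ω => ω.2.1.1) (fun ω => ω.2.2.2.1) :=
    mutualInfo_comp hZ (fun ω => ω.2.1.1) (fun ω => ω.2.2.2.1)
  have m₂ : condMutualInfo (jointMass z q) (fun ω => ω.u₂) (fun ω => (ω.v, ω.y₁))
      (fun ω => ω.u₁) = condMutualInfo J (fun ω => ω.2.1.2) (fun ω => (ω.2.2.1, ω.2.2.2.1))
        (fun ω => ω.2.1.1) :=
    condMutualInfo_comp hZ (fun ω => ω.2.1.2) (fun ω => (ω.2.2.1, ω.2.2.2.1)) (fun ω => ω.2.1.1)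
  have m₃ : mutualInfo (jointMass z q) (fun ω => ω.s₁) (fun ω => (ω.u₁, ω.u₂)) =
      mutualInfo J (fun ω => ω.1) (fun ω => ω.2.1) :=
    mutualInfo_comp hZ (fun ω => ω.1) (fun ω => ω.2.1)
  have m₄ : mutualInfo (jointMass z q) (fun ω => ω.v) (fun ω => (ω.u₁, ω.y₁)) =
      mutualInfo J (fun ω => ω.2.2.1) (fun ω => (ω.2.1.1, ω.2.2.2.1)) :=
    mutualInfo_comp hZ (fun ω => ω.2.2.1) (fun ω => (ω.2.1.1, ω.2.2.2.1))
  have m₅ : mutualInfo (jointMass z q) (fun ω => ω.s₁) (fun ω => ω.v) =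
      mutualInfo J (fun ω => ω.1) (fun ω => ω.2.2.1) :=
    mutualInfo_comp hZ (fun ω => ω.1) (fun ω => ω.2.2.1)
  have m₆ : mutualInfo (jointMass z q) (fun ω => ω.v) (fun ω => ω.y₂) =
      mutualInfo J (fun ω => ω.2.2.1) (fun ω => ω.2.2.2.2) :=
    mutualInfo_comp hZ (fun ω => ω.2.2.1) (fun ω => ω.2.2.2.2)
  rw [m₄, m₆] at hcond
  rw [m₁, m₂, m₃] at h₁
  rw [m₄, m₅] at h₂ h₂'
  -- Each bin rate exceeds its mutual information by one δ. Both enter the sum condition of the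
  -- first decoder, hence the slack 2δ.
  have hδ : ∀ {R B : ℝ}, (R = 0 ∨ R < B) → ∃ δ, 0 < δ ∧ (R = 0 ∨ R + 2 * δ < B) := by
    rintro R B (h | h)
    · exact ⟨1, one_pos, Or.inl h⟩
    · exact ⟨(B - R) / 3, by linarith, Or.inr (by linarith)⟩
  obtain ⟨δ₁, hδ₁, hb₁⟩ := hδ h₁
  obtain ⟨δ₂, hδ₂, hb₂⟩ := hδ h₂
  have hδ0 : 0 < min δ₁ δ₂ := lt_min hδ₁ hδ₂
  have hδl := min_le_left δ₁ δ₂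
  have hδr := min_le_right δ₁ δ₂
  obtain ⟨b, hb, hcode⟩ := (z.binningModel q).exists_codes_of_mutualInfo (R₁ := R₁) hR₂
    (lt_add_of_pos_right _ hδ0) (lt_add_of_pos_right _ hδ0)
    (hb₁.imp_right fun h => ⟨by rw [← hJ]; linarith, by rw [← hJ]; linarith⟩)
    -- Here I(V;U₁Y₁) ≤ I(V;Y₂) turns the bound on R₂ into the decoding condition of receiver 2.
    (hb₂.imp_right fun h => by rw [← hJ]; linarith)
  choose e₁ e₂ d₁ d₂ he using hcode
  refine ⟨hR₁, hR₂, fun n => ⟨fun w s _ => e₁ n w s, fun w s _ => e₂ n w s, d₁ n, d₂ n⟩, ?_⟩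
  refine squeeze_zero (fun n => Code.avgError_nonneg _ _) (fun n => ?_) hb
  exact (avgError_eq_errorProb z q (e₁ n) (e₂ n) (d₁ n) (d₂ n)).trans_le (he n)

end StateIC

/-! ### The proposition: strict rates directly, the others as limits -/

theorem proposition4
    {S₁ S₂ X₁ X₂ Y₁ Y₂ U₁ U₂ V : Type*}
    [Fintype S₁] [Fintype S₂] [Fintype X₁] [Fintype X₂] [Fintype Y₁] [Fintype Y₂]
    [Fintype U₁] [Fintype U₂] [Fintype V]
    (z : StateIC.ZChannel S₁ S₂ X₁ X₂ Y₁ Y₂) (q : StateIC.InputLaws S₁ X₁ X₂ U₁ U₂ V)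
    (p : StateIC.Outcome S₁ S₂ X₁ X₂ Y₁ Y₂ U₁ U₂ V → ℝ) (hp : p = StateIC.jointMass z q)
    -- `I(V; U₁Y₁) ≤ I(V; Y₂)`
    (hcond : StateIC.mutualInfo p (fun ω => ω.v) (fun ω => (ω.u₁, ω.y₁)) ≤
      StateIC.mutualInfo p (fun ω => ω.v) (fun ω => ω.y₂))
    (B₁ B₂ : ℝ)
    -- `B₁ = I(U₁; Y₁) + I(U₂; VY₁ | U₁) - I(S₁; U₁U₂)`
    (hB₁ : B₁ = StateIC.mutualInfo p (fun ω => ω.u₁) (fun ω => ω.y₁) +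
      StateIC.condMutualInfo p (fun ω => ω.u₂) (fun ω => (ω.v, ω.y₁)) (fun ω => ω.u₁) -
      StateIC.mutualInfo p (fun ω => ω.s₁) (fun ω => (ω.u₁, ω.u₂)))
    -- `B₂ = I(V; U₁Y₁) - I(S₁; V)`
    (hB₂ : B₂ = StateIC.mutualInfo p (fun ω => ω.v) (fun ω => (ω.u₁, ω.y₁)) -
      StateIC.mutualInfo p (fun ω => ω.s₁) (fun ω => ω.v))
    (R₁ R₂ : ℝ) (hR₁ : 0 ≤ R₁) (hR₂ : 0 ≤ R₂) :
    (R₁ ≤ B₁ → R₂ ≤ B₂ → (R₁, R₂) ∈ z.toChannel.capacityRegion) ∧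
      (R₁ < B₁ → R₂ < B₂ → z.toChannel.Achievable (R₁, R₂)) := by
  subst hp hB₁ hB₂
  refine ⟨fun h₁ h₂ => ?_, fun h₁ h₂ =>
    StateIC.achievable_of_rate_bounds z q hcond hR₁ hR₂ (Or.inr h₁) (Or.inr h₂) h₂.le⟩
  -- Lowering a rate by ε makes its bound strict unless the rate is cut off at zero. The bound
  -- itself may then be zero, and the single-message case is used.
  have hreduce : ∀ {R B ε : ℝ}, R ≤ B → 0 < ε → max (R - ε) 0 = 0 ∨ max (R - ε) 0 < B := by
    intro R B ε hRB hε
    rcases le_total (R - ε) 0 with h | h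
    · exact Or.inl (max_eq_right h)
    · rw [max_eq_left h]
      exact Or.inr (by linarith)
  have hlim : ∀ {R : ℝ}, 0 ≤ R →
      Filter.Tendsto (fun ε : ℝ => max (R - ε) 0) (nhdsWithin 0 (Set.Ioi 0)) (nhds R) := by
    intro R hR
    have hc : Continuous fun ε : ℝ => max (R - ε) 0 := by fun_prop
    have := hc.tendsto 0
    rw [sub_zero, max_eq_left hR] at this
    exact this.mono_left nhdsWithin_le_nhds
  refine mem_closure_of_tendsto ((hlim hR₁).prodMk_nhds (hlim hR₂)) ?_
  filter_upwards [self_mem_nhdsWithin] with ε hε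
  refine StateIC.achievable_of_rate_bounds z q hcond (le_max_right _ _) (le_max_right _ _)
    (hreduce h₁ hε) (hreduce h₂ hε) (max_le ?_ (hR₂.trans h₂))
  have hε' : 0 < ε := hε
  linarith
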